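/- **Setting.** Let $\mu_e,\lambda_e,\mu_c,\mu_m,\lambda_m,a_1,a_2,L_c$ be real parameters, and put $\widetilde a=\frac{a_1+a_2}{2}$, $\kappa_e=\lambda_e+\mu_e$, $\kappa_m=\lambda_m+\mu_m$, $$\mu_M=\frac{\mu_e\mu_m}{\mu_e+\mu_m},\qquad \kappa_M=\frac{\kappa_e\kappa_m}{\kappa_e+\kappa_m},\qquad \beta=\frac{(\kappa_e+\mu_e)(\kappa_m+\mu_m)}{(\kappa_e+\kappa_m)(\mu_e+\mu_m)},$$ $$\zeta=\frac{\mu_M}{\mu_m}-\frac{\kappa_M}{\kappa_m},\qquad \varepsilon=\frac{\kappa_m}{\kappa_M+\mu_M}\,\beta .$$ Assume $\mu_m>0$, $\mu_c>0$, $\mu_e>0$, $\kappa_m>0$, $\kappa_e>0$, $\widetilde a L_c^2>0$ and $L_c>0$. The characteristic lengths are $$\ell_1=L_c\sqrt{\frac{\widetilde a\,\beta\,\mu_M}{4(\kappa_M+\mu_M)}},\qquad \ell_2=L_c\sqrt{\frac{\widetilde a\,\mu_M(\mu_e+\mu_c)}{4\mu_c\mu_e}} .$$ For $x=(x_1,x_2)\in\mathbb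 R^2\setminus\{0\}$ let $r=\sqrt{x_1^2+x_2^2}$, let $K_n$ be the modified Bessel function of the second kind of order $n$, and for $j=1,2$ let $$\Phi_j(r)=\frac{2\ell_j^2}{r^2}-K_2\!\left(\frac r{\ell_j}\right),\qquad \Psi_j(r)=\frac1r\left(1-\frac r{\ell_j}K_1\!\left(\frac r{\ell_j}\right)\right).$$ The equilibrium equations of the isotropic plane-strain relaxed micromorphic model for the displacement $u=(u_1,u_2)$ and the micro-distortion $P=(P_{ij})_{i,j=1,2}$ are $$\operatorname{Div}\sigma=f,\qquad \sigma-\sigma_m-\mu_ML_c^2\,\widetilde a\,\operatorname{Curl}\operatorname{Curl}_{2D}P=M,$$ where $\sigma=2\mu_e\operatorname{sym}(\mathrm Du-P)+2\mu_c\operatorname{skew}(\mathrm Du-P)+\lambda_e\operatorname{tr}(\mathrm Du-P)\mathbb 1$, $\sigma_m=2\mu_m\operatorname{sym}P+\lambda_m\operatorname{tr}(P)\mathbb 1$, $(\mathrm Du)_{ij}=u_{i,j}$, $(\operatorname{Div}\sigma)_i=\sigma_{i1,1}+\sigma_{i2,2}$, and $\operatorname{Curl}\operatorname{Curl}_{2D}P$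 is the $2\times2$ matrix with $i$-th row $(v_{i,2},-v_{i,1})$, where $v_i=P_{i2,1}-P_{i1,2}$. **Theorem.** Define, for $x\neq0$, $$u_1=\frac{\kappa_M x_1x_2}{4\pi\mu_M(\kappa_M+\mu_M)r^2}+\frac{\zeta^2x_1x_2}{2\pi\beta(\kappa_M+\mu_M)r^2}\Phi_1-\frac{\mu_cx_1x_2}{2\pi\mu_e(\mu_c+\mu_e)r^2}\Phi_2,$$ $$u_2=\frac{\kappa_Mx_2^2}{4\pi\mu_M(\kappa_M+\mu_M)r^2}-\frac{\kappa_M+2\mu_M}{4\pi\mu_M(\kappa_M+\mu_M)}\ln r-\frac{\zeta^2}{4\pi\beta(\kappa_M+\mu_M)}\left(\frac{x_1^2-x_2^2}{r^2}\Phi_1+K_0\!\left(\tfrac r{\ell_1}\right)\right)+\frac{\mu_c}{4\pi\mu_e(\mu_c+\mu_e)}\left(\frac{x_1^2-x_2^2}{r^2}\Phi_2-K_0\!\left(\tfrac r{\ell_2}\right)\right),$$ $$P_{11}=-\frac{\kappa_Mx_2(x_1^2-x_2^2)}{4\pi\mu_m(\kappa_M+\mu_M)r^4}+\frac{\zeta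 x_2}{4\pi(\kappa_M+\mu_M)r}\Psi_1-\frac{\zeta\varepsilon x_2(x_1^2-x_2^2)}{2\pi(\kappa_m+\mu_m)\beta r^4}\Phi_1+\frac{\zeta\varepsilon x_1x_2}{2\pi(\kappa_m+\mu_m)\beta r^2}\,\partial_{x_1}\Phi_1,$$ $$P_{12}=\frac{\kappa_Mx_1(x_1^2-x_2^2)}{4\pi\mu_m(\kappa_M+\mu_M)r^4}+\frac{x_1}{4\pi\mu_er}\Psi_2+\frac{\zeta\varepsilon x_1(x_1^2-x_2^2)}{2\pi(\kappa_m+\mu_m)\beta r^4}\Phi_1+\frac{\zeta\varepsilon x_1x_2}{2\pi(\kappa_m+\mu_m)\beta r^2}\,\partial_{x_2}\Phi_1,$$ $$P_{21}=\frac{\kappa_Mx_1(x_1^2-x_2^2)}{4\pi\mu_m(\kappa_M+\mu_M)r^4}-\frac{x_1}{4\pi\mu_er}\Psi_2+\frac{\zeta\varepsilon x_1(x_1^2-x_2^2)}{2\pi(\kappa_m+\mu_m)\beta r^4}\Phi_1+\frac{\zeta\varepsilon x_1x_2}{2\pi(\kappa_m+\mu_m)\beta r^2}\,\partial_{x_2}\Phi_1-\frac{x_1}{2\pi\mu_mr^2},$$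 $$P_{22}=-\frac{x_2}{2\pi(\kappa_m+\mu_m)r^2}+\frac{\kappa_Mx_2(x_1^2-x_2^2)}{4\pi\mu_m(\kappa_M+\mu_M)r^4}-\frac{\zeta(\kappa_m-\mu_m)x_2}{4\pi(\kappa_M+\mu_M)(\kappa_m+\mu_m)r}\Psi_1+\frac{\zeta\varepsilon x_2(x_1^2-x_2^2)}{2\pi(\kappa_m+\mu_m)\beta r^4}\Phi_1-\frac{\zeta\varepsilon x_1x_2}{2\pi(\kappa_m+\mu_m)\beta r^2}\,\partial_{x_1}\Phi_1 .$$ Then: 1. all $u_i$ and $P_{ij}$ are locally integrable on $\mathbb R^2$, and $(u,P)$ solves the equilibrium equations on all of $\mathbb R^2$, in the sense of distributions, with the concentrated force $f=(0,-1)^T\delta$ at the origin ($\delta$ the Dirac distribution) and $M=0$; 2. as $r\to0$, the displacement is logarithmically singular: $u_1=O(1)$ and $u_2=-C\ln r+O(1)$ for some constant $C>0$; 3. as $r\to0$, $P_{ij}=O(r^{-1})$ for all $i,j$, and the Frobenius norm $\|P\|$ is of exact order $r^{-1}$, i.e. bounded above and below by positive multiples of $r^{-1}$ near the origin. -/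

import Mathlib

open MeasureTheory Filter Topology Asymptotics
open scoped Distributions LineDeriv

noncomputable section

namespace RelaxedMicromorphic

/-! ### Distributions on the plane and the differential operators of the plane-strain model -/

/-- The plane `ℝ²` with its Euclidean norm; the coordinates `x₁, x₂` of `x` are `x 0, x 1` and
`r = ‖x‖`. -/
abbrev Plane := EuclideanSpace ℝ (Fin 2)

/-- Real-valued distributions on the whole plane. -/
abbrev PlaneDist := 𝓓'((⊤ : TopologicalSpace.Opens Plane), ℝ)

/-- The coordinate unit vectors. -/
def unitVec (i : Fin 2) : Plane := EuclideanSpace.single i 1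

/-- The regular distribution `φ ↦ ∫ φ f` of a locally integrable function `f`. -/
def regularDist (f : Plane → ℝ) : PlaneDist :=
  UniformConvergenceCLM.ofFun _ _ _
    (TestFunction.integralAgainstBilinCLM (ContinuousLinearMap.mul ℝ ℝ) volume f)

theorem regularDist_apply {f : Plane → ℝ} (hf : LocallyIntegrable f volume)
    (φ : 𝓓((⊤ : TopologicalSpace.Opens Plane), ℝ)) :
    regularDist f φ = ∫ x, φ x * f x :=
  TestFunction.integralAgainstBilinCLM_eq_integral (hf.locallyIntegrableOn _)

/-- The distributional partial derivative `∂T/∂x_i`. -/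
def pd (i : Fin 2) (T : PlaneDist) : PlaneDist := ∂_{unitVec i} T

/-- The displacement gradient `(D u)_{ij} = u_{i,j}`. -/
def grad (u : Fin 2 → PlaneDist) : Matrix (Fin 2) (Fin 2) PlaneDist :=
  Matrix.of fun i j => pd j (u i)

/-- The row-wise divergence `(Div S)_i = S_{i1,1} + S_{i2,2}`. -/
def rowDiv (S : Matrix (Fin 2) (Fin 2) PlaneDist) : Fin 2 → PlaneDist :=
  fun i => ∑ j, pd j (S i j)

/-- `Curl_2D P = (P_{12,1} - P_{11,2}, P_{22,1} - P_{21,2})`. -/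
def curl2D (P : Matrix (Fin 2) (Fin 2) PlaneDist) : Fin 2 → PlaneDist :=
  fun i => pd 0 (P i 1) - pd 1 (P i 0)

/-- `Curl Curl_2D P`, whose `i`-th row is `(v_{i,2}, -v_{i,1})` with `v = Curl_2D P`. -/
def curlCurl2D (P : Matrix (Fin 2) (Fin 2) PlaneDist) : Matrix (Fin 2) (Fin 2) PlaneDist :=
  Matrix.of fun i => ![pd 1 (curl2D P i), -pd 0 (curl2D P i)]

/-- The symmetric part of a matrix of distributions. -/
def symPart (X : Matrix (Fin 2) (Fin 2) PlaneDist) : Matrix (Fin 2) (Fin 2) PlaneDist :=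
  (1 / 2 : ℝ) • (X + X.transpose)

/-- The skew-symmetric part of a matrix of distributions. -/
def skewPart (X : Matrix (Fin 2) (Fin 2) PlaneDist) : Matrix (Fin 2) (Fin 2) PlaneDist :=
  (1 / 2 : ℝ) • (X - X.transpose)

/-- The spherical matrix `tr(X) 𝟙`. -/
def trId (X : Matrix (Fin 2) (Fin 2) PlaneDist) : Matrix (Fin 2) (Fin 2) PlaneDist :=
  Matrix.diagonal fun _ => X.trace

/-! ### The material -/

/-- The parameters of the isotropic relaxed micromorphic model that enter the plane-strain
problem: `μ_e, λ_e, μ_c, μ_m, λ_m` (`m` for micro), the curvature parameters `a₁, a₂` and the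
internal length `L_c`. -/
structure Moduli where
  muE : ℝ
  lamE : ℝ
  muC : ℝ
  muMicro : ℝ
  lamMicro : ℝ
  a1 : ℝ
  a2 : ℝ
  Lc : ℝ

namespace Moduli

variable (c : Moduli)

/-- `ã = (a₁ + a₂) / 2`. -/
def aTilde : ℝ := (c.a1 + c.a2) / 2

/-- The plane-strain bulk modulus `κ_e = λ_e + μ_e`. -/
def kappaE : ℝ := c.lamE + c.muE

/-- The plane-strain bulk modulus `κ_m = λ_m + μ_m`. -/
def kappaMicro : ℝ := c.lamMicro + c.muMicro

/-- The macroscopic shear modulus `μ_M`. -/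
def muMacro : ℝ := c.muE * c.muMicro / (c.muE + c.muMicro)

/-- The macroscopic plane-strain bulk modulus `κ_M`. -/
def kappaMacro : ℝ := c.kappaE * c.kappaMicro / (c.kappaE + c.kappaMicro)

/-- Positive definiteness of the plane-strain energy. -/
structure PositiveDefinite : Prop where
  muMicro_pos : 0 < c.muMicro
  muC_nonneg : 0 ≤ c.muC
  muE_pos : 0 < c.muE
  kappaMicro_pos : 0 < c.kappaMicro
  kappaE_pos : 0 < c.kappaE
  curvature_pos : 0 < c.aTilde * c.Lc ^ 2

/-- The dimensionless parameter `β`. -/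
def beta : ℝ :=
  (c.kappaE + c.muE) * (c.kappaMicro + c.muMicro) /
    ((c.kappaE + c.kappaMicro) * (c.muE + c.muMicro))

/-- The dimensionless parameter `ζ`. -/
def zeta : ℝ := c.muMacro / c.muMicro - c.kappaMacro / c.kappaMicro

/-- The dimensionless parameter `ε`. -/
def eps : ℝ := c.kappaMicro / (c.kappaMacro + c.muMacro) * c.beta

/-- The characteristic length `ℓ₁`. -/
def ell1 : ℝ :=
  c.Lc * √(c.aTilde * c.beta * c.muMacro / (4 * (c.kappaMacro + c.muMacro)))

/-- The characteristic length `ℓ₂`. -/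
def ell2 : ℝ :=
  c.Lc * √(c.aTilde * c.muMacro * (c.muE + c.muC) / (4 * c.muC * c.muE))

/-! ### The equilibrium equations -/

/-- The elastic force stress
`σ = 2 μ_e sym (Du - P) + 2 μ_c skew (Du - P) + λ_e tr (Du - P) 𝟙`. -/
def stress (u : Fin 2 → PlaneDist) (P : Matrix (Fin 2) (Fin 2) PlaneDist) :
    Matrix (Fin 2) (Fin 2) PlaneDist :=
  (2 * c.muE) • symPart (grad u - P) + (2 * c.muC) • skewPart (grad u - P)
    + c.lamE • trId (grad u - P)

/-- The micro-stress `σ_m = 2 μ_m sym P + λ_m tr P 𝟙`. -/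
def microStress (P : Matrix (Fin 2) (Fin 2) PlaneDist) : Matrix (Fin 2) (Fin 2) PlaneDist :=
  (2 * c.muMicro) • symPart P + c.lamMicro • trId P

/-- The plane-strain equilibrium equations on the whole plane, in the sense of distributions:
`Div σ = f` and `σ - σ_m - μ_M L_c² ã Curl Curl_2D P = M`. -/
def Equilibrium (u : Fin 2 → PlaneDist) (P : Matrix (Fin 2) (Fin 2) PlaneDist)
    (f : Fin 2 → PlaneDist) (M : Matrix (Fin 2) (Fin 2) PlaneDist) : Prop :=
  rowDiv (c.stress u P) = f ∧
    c.stress u P - c.microStress P - (c.muMacro * c.Lc ^ 2 * c.aTilde) • curlCurl2D P = M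

end Moduli

/-! ### The closed-form fields -/

/-- The modified Bessel function of the second kind `K_n(z)`, `z > 0`, of integer order, by its
integral representation `K_n(z) = ∫₀^∞ exp (-z cosh t) cosh (n t) dt`. -/
def besselK (n : ℕ) (z : ℝ) : ℝ :=
  ∫ t in Set.Ioi (0 : ℝ), Real.exp (-z * Real.cosh t) * Real.cosh (n * t)

/-- `Φ(r) = 2 ℓ² / r² - K₂(r / ℓ)`. -/
def Phi (l r : ℝ) : ℝ := 2 * l ^ 2 / r ^ 2 - besselK 2 (r / l)

/-- `Ψ(r) = (1 / r) (1 - (r / ℓ) K₁(r / ℓ))`. -/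
def Psi (l r : ℝ) : ℝ := 1 / r * (1 - r / l * besselK 1 (r / l))

/-- The partial derivative `∂/∂x_i` of `x ↦ Φ(‖x‖)` at `x`. -/
def dPhi (l : ℝ) (i : Fin 2) (x : Plane) : ℝ :=
  lineDeriv ℝ (fun y : Plane => Phi l ‖y‖) x (unitVec i)

namespace Moduli

variable (c : Moduli)

open Real in
/-- The displacement component `u₁`. -/
def greenU1 (x : Plane) : ℝ :=
  c.kappaMacro * x 0 * x 1 / (4 * π * c.muMacro * (c.kappaMacro + c.muMacro) * ‖x‖ ^ 2)
  + c.zeta ^ 2 * x 0 * x 1 / (2 * π * c.beta * (c.kappaMacro + c.muMacro) * ‖x‖ ^ 2)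
      * Phi c.ell1 ‖x‖
  - c.muC * x 0 * x 1 / (2 * π * c.muE * (c.muC + c.muE) * ‖x‖ ^ 2) * Phi c.ell2 ‖x‖

open Real in
/-- The displacement component `u₂`. -/
def greenU2 (x : Plane) : ℝ :=
  c.kappaMacro * x 1 ^ 2 / (4 * π * c.muMacro * (c.kappaMacro + c.muMacro) * ‖x‖ ^ 2)
  - (c.kappaMacro + 2 * c.muMacro) / (4 * π * c.muMacro * (c.kappaMacro + c.muMacro)) * log ‖x‖
  - c.zeta ^ 2 / (4 * π * c.beta * (c.kappaMacro + c.muMacro))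
      * ((x 0 ^ 2 - x 1 ^ 2) / ‖x‖ ^ 2 * Phi c.ell1 ‖x‖ + besselK 0 (‖x‖ / c.ell1))
  + c.muC / (4 * π * c.muE * (c.muC + c.muE))
      * ((x 0 ^ 2 - x 1 ^ 2) / ‖x‖ ^ 2 * Phi c.ell2 ‖x‖ - besselK 0 (‖x‖ / c.ell2))

open Real in
/-- The micro-distortion component `P₁₁`. -/
def greenP11 (x : Plane) : ℝ :=
  -(c.kappaMacro * x 1 * (x 0 ^ 2 - x 1 ^ 2)
      / (4 * π * c.muMicro * (c.kappaMacro + c.muMacro) * ‖x‖ ^ 4))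
  + c.zeta * x 1 / (4 * π * (c.kappaMacro + c.muMacro) * ‖x‖) * Psi c.ell1 ‖x‖
  - c.zeta * c.eps * x 1 * (x 0 ^ 2 - x 1 ^ 2)
      / (2 * π * (c.kappaMicro + c.muMicro) * c.beta * ‖x‖ ^ 4) * Phi c.ell1 ‖x‖
  + c.zeta * c.eps * x 0 * x 1 / (2 * π * (c.kappaMicro + c.muMicro) * c.beta * ‖x‖ ^ 2)
      * dPhi c.ell1 0 x

open Real in
/-- The micro-distortion component `P₁₂`. -/
def greenP12 (x : Plane) : ℝ :=
  c.kappaMacro * x 0 * (x 0 ^ 2 - x 1 ^ 2)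
      / (4 * π * c.muMicro * (c.kappaMacro + c.muMacro) * ‖x‖ ^ 4)
  + x 0 / (4 * π * c.muE * ‖x‖) * Psi c.ell2 ‖x‖
  + c.zeta * c.eps * x 0 * (x 0 ^ 2 - x 1 ^ 2)
      / (2 * π * (c.kappaMicro + c.muMicro) * c.beta * ‖x‖ ^ 4) * Phi c.ell1 ‖x‖
  + c.zeta * c.eps * x 0 * x 1 / (2 * π * (c.kappaMicro + c.muMicro) * c.beta * ‖x‖ ^ 2)
      * dPhi c.ell1 1 x

open Real in
/-- The micro-distortion component `P₂₁`. -/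
def greenP21 (x : Plane) : ℝ :=
  c.kappaMacro * x 0 * (x 0 ^ 2 - x 1 ^ 2)
      / (4 * π * c.muMicro * (c.kappaMacro + c.muMacro) * ‖x‖ ^ 4)
  - x 0 / (4 * π * c.muE * ‖x‖) * Psi c.ell2 ‖x‖
  + c.zeta * c.eps * x 0 * (x 0 ^ 2 - x 1 ^ 2)
      / (2 * π * (c.kappaMicro + c.muMicro) * c.beta * ‖x‖ ^ 4) * Phi c.ell1 ‖x‖
  + c.zeta * c.eps * x 0 * x 1 / (2 * π * (c.kappaMicro + c.muMicro) * c.beta * ‖x‖ ^ 2)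
      * dPhi c.ell1 1 x
  - x 0 / (2 * π * c.muMicro * ‖x‖ ^ 2)

open Real in
/-- The micro-distortion component `P₂₂`. -/
def greenP22 (x : Plane) : ℝ :=
  -(x 1 / (2 * π * (c.kappaMicro + c.muMicro) * ‖x‖ ^ 2))
  + c.kappaMacro * x 1 * (x 0 ^ 2 - x 1 ^ 2)
      / (4 * π * c.muMicro * (c.kappaMacro + c.muMacro) * ‖x‖ ^ 4)
  - c.zeta * (c.kappaMicro - c.muMicro) * x 1
      / (4 * π * (c.kappaMacro + c.muMacro) * (c.kappaMicro + c.muMicro) * ‖x‖) * Psi c.ell1 ‖x‖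
  + c.zeta * c.eps * x 1 * (x 0 ^ 2 - x 1 ^ 2)
      / (2 * π * (c.kappaMicro + c.muMicro) * c.beta * ‖x‖ ^ 4) * Phi c.ell1 ‖x‖
  - c.zeta * c.eps * x 0 * x 1 / (2 * π * (c.kappaMicro + c.muMicro) * c.beta * ‖x‖ ^ 2)
      * dPhi c.ell1 0 x

/-- The displacement field of the concentrated force, componentwise. -/
def greenU : Fin 2 → Plane → ℝ := ![c.greenU1, c.greenU2]

/-- The micro-distortion field of the concentrated force, componentwise. -/
def greenP : Matrix (Fin 2) (Fin 2) (Plane → ℝ) :=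
  !![c.greenP11, c.greenP12; c.greenP21, c.greenP22]

end Moduli

end RelaxedMicromorphic

end

open RelaxedMicromorphic

/-! All fields are combinations of derivatives of four radial potentials: `L = log r`, `B = r² log
r`, and `H`, `K`, which are `K₀(r / ℓ) + log r` with `ℓ = ℓ₁`, `ℓ₂`. Up to lower-order corrections,
the displacement consists of second derivatives of `B`, of the gradient of a multiple of `∂₂H`, and
of the rotated gradient of a multiple of `∂₁K`; the micro-distortion consists of first derivatives
of `L`, `H`, `K` and third derivatives of `B`, `H`.

Away from the origin this is calculus. Across the origin it rests on one principle
(`Represents.pd`): if a locally integrable function and its pointwise derivative off the origin are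
both locally integrable, then the pointwise derivative is the distributional one, because almost
every coordinate line misses the origin. All derivatives needed to identify the fields are `O(1 /
r)`, hence locally integrable. For `H` and `K` this works because the logarithmic singularity of
`K₀` is cancelled. The Dirac mass comes from `Δ L = 2πδ` alone (`laplacian_logDist`), proved in
polar coordinates.

The other Laplacians are `Δ B = 4L + 4`, `Δ H = (H - L) / ℓ₁²` and `Δ K = (K - L) / ℓ₂²`. Since
partial derivatives commute, these relations turn the equilibrium equations into finitely many
rational identities in the moduli (`equilibrium_of_potentials`).

The singular behaviour follows from elementary Bessel estimates: `0 ≤ Φ ≤ 1 / 2`, `0 ≤ Ψ ≤ 1 / ℓ`,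
and `K₀(z) + log z` bounded for `0 < z ≤ 1`. The Bessel terms change the coefficient of the
logarithm in `u₂` but cannot cancel it (`Moduli.coefLog_sub_pos`). For the lower bound on `P`, the
trace and the skew part isolate multiples of `x₂ / r²` and `x₁ / r²` up to bounded terms
(`Moduli.exists_one_div_norm_le`). -/

namespace RelaxedMicromorphic

/-! ### Coordinates on the plane -/

/-- The plane as a product, the second factor running in the direction of `unitVec i`. -/
def planeEquiv : (i : Fin 2) → ℝ × ℝ ≃ᵐ Plane
  | 0 => MeasurableEquiv.prodComm.trans
      ((MeasurableEquiv.finTwoArrow (α := ℝ)).symm.trans (MeasurableEquiv.toLp 2 (Fin 2 → ℝ)))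
  | 1 => (MeasurableEquiv.finTwoArrow (α := ℝ)).symm.trans (MeasurableEquiv.toLp 2 (Fin 2 → ℝ))

theorem planeEquiv_zero_apply (p : ℝ × ℝ) : planeEquiv 0 p = !₂[p.2, p.1] := rfl

theorem planeEquiv_one_apply (p : ℝ × ℝ) : planeEquiv 1 p = !₂[p.1, p.2] := rfl

theorem measurePreserving_planeEquiv (i : Fin 2) : MeasurePreserving (planeEquiv i) := by
  have h : MeasurePreserving ((MeasurableEquiv.finTwoArrow (α := ℝ)).symm.trans
      (MeasurableEquiv.toLp 2 (Fin 2 → ℝ))) :=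
    (PiLp.volume_preserving_toLp (Fin 2)).comp ((volume_preserving_finTwoArrow ℝ).symm _)
  fin_cases i
  · exact h.comp Measure.measurePreserving_swap
  · exact h

theorem planeEquiv_add (i : Fin 2) (y t s : ℝ) :
    planeEquiv i (y, t + s) = planeEquiv i (y, t) + s • unitVec i := by
  fin_cases i <;> ext j <;> fin_cases j <;>
    simp [planeEquiv_zero_apply, planeEquiv_one_apply, unitVec]

theorem planeEquiv_ne_zero (i : Fin 2) {y : ℝ} (hy : y ≠ 0) (t : ℝ) :
    planeEquiv i (y, t) ≠ 0 := by
  intro h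
  fin_cases i
  · exact hy (by simpa [planeEquiv_zero_apply] using congrArg (fun v : Plane => v 1) h)
  · exact hy (by simpa [planeEquiv_one_apply] using congrArg (fun v : Plane => v 0) h)

theorem hasDerivAt_planeEquiv {f : Plane → ℝ} {f' : ℝ} {i : Fin 2} {y t : ℝ}
    (h : HasLineDerivAt ℝ f f' (planeEquiv i (y, t)) (unitVec i)) :
    HasDerivAt (fun s => f (planeEquiv i (y, s))) f' t := by
  have h' : HasDerivAt (fun s => f (planeEquiv i (y, t) + s • unitVec i)) f' (t - t) := by
    rw [sub_self]; exact h
  have := h'.comp_sub_const t t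
  refine this.congr_of_eventuallyEq (Eventually.of_forall fun s => ?_)
  simp only [← planeEquiv_add, add_sub_cancel]

/-- A function that is differentiable in the direction `unitVec i` away from the origin, and is
integrable together with its derivative, has a derivative of zero integral. -/
theorem integral_lineDeriv_eq_zero {g g' : Plane → ℝ} {i : Fin 2} (hg : Integrable g)
    (hg' : Integrable g') (h : ∀ x ≠ 0, HasLineDerivAt ℝ g (g' x) x (unitVec i)) :
    ∫ x, g' x = 0 := by
  have e := measurePreserving_planeEquiv i
  have hi : Integrable (fun p => g (planeEquiv i p)) (volume.prod volume) :=
    e.integrable_comp_of_integrable hg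
  have hi' : Integrable (fun p => g' (planeEquiv i p)) (volume.prod volume) :=
    e.integrable_comp_of_integrable hg'
  rw [← e.integral_comp (planeEquiv i).measurableEmbedding, Measure.volume_eq_prod,
    integral_prod _ hi']
  refine integral_eq_zero_of_ae ?_
  -- Here `y` is the transversal coordinate; `y ≠ 0` discards the single line through the origin, so
  -- the function is differentiable along every remaining line.
  filter_upwards [hi.prod_right_ae, hi'.prod_right_ae, Measure.ae_ne volume (0 : ℝ)]
    with y h1 h2 hy
  exact integral_eq_zero_of_hasDerivAt_of_integrable
    (fun t => hasDerivAt_planeEquiv (h _ (planeEquiv_ne_zero i hy t))) h2 h1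

/-! ### Regular distributions -/

theorem pd_apply (i : Fin 2) (T : PlaneDist) (φ : 𝓓((⊤ : TopologicalSpace.Opens Plane), ℝ)) :
    pd i T φ = -T (∂_{unitVec i} φ) := by
  simp [pd]

theorem testFunction_lineDeriv_apply (φ : 𝓓((⊤ : TopologicalSpace.Opens Plane), ℝ)) (v x : Plane) :
    (∂_{v} φ) x = lineDeriv ℝ φ x v := by
  rw [TestFunction.lineDerivOp_eq_lineDerivCLM ℝ]
  simp [TestFunction.lineDerivCLM_apply]

theorem testFunction_hasLineDerivAt (φ : 𝓓((⊤ : TopologicalSpace.Opens Plane), ℝ)) (v x : Plane) :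
    HasLineDerivAt ℝ φ ((∂_{v} φ) x) x v := by
  rw [testFunction_lineDeriv_apply]
  exact ((φ.contDiff.differentiable (by simp)) x).lineDifferentiableAt.hasLineDerivAt

theorem integrable_testFunction_mul {f : Plane → ℝ} (hf : LocallyIntegrable f)
    (φ : 𝓓((⊤ : TopologicalSpace.Opens Plane), ℝ)) : Integrable (fun x => φ x * f x) :=
  φ.integrable_bilin (ContinuousLinearMap.mul ℝ ℝ) (hf.locallyIntegrableOn _)

/-- The function `f` is locally integrable and its regular distribution is `T`. -/
def Represents (f : Plane → ℝ) (T : PlaneDist) : Prop :=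
  LocallyIntegrable f volume ∧ regularDist f = T

namespace Represents

variable {f g : Plane → ℝ} {S T : PlaneDist}

theorem of_locallyIntegrable (hf : LocallyIntegrable f) : Represents f (regularDist f) :=
  ⟨hf, rfl⟩

theorem apply (h : Represents f T) (φ : 𝓓((⊤ : TopologicalSpace.Opens Plane), ℝ)) :
    T φ = ∫ x, φ x * f x := by
  rw [← h.2, regularDist_apply h.1]

theorem add (hf : Represents f T) (hg : Represents g S) :
    Represents (fun x => f x + g x) (T + S) := by
  have h := hf.1.add hg.1
  refine ⟨h, ?_⟩
  ext φ
  refine (regularDist_apply h φ).trans ?_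
  change _ = T φ + S φ
  rw [hf.apply, hg.apply, ← integral_add (integrable_testFunction_mul hf.1 φ)
    (integrable_testFunction_mul hg.1 φ)]
  simp [mul_add]

theorem smul (hf : Represents f T) (a : ℝ) : Represents (fun x => a * f x) (a • T) := by
  have h := hf.1.smul a
  refine ⟨h, ?_⟩
  ext φ
  refine (regularDist_apply h φ).trans ?_
  change _ = a * T φ
  rw [hf.apply, ← integral_const_mul]
  simp [mul_left_comm]

theorem sub (hf : Represents f T) (hg : Represents g S) :
    Represents (fun x => f x - g x) (T - S) := by
  have := hf.add (hg.smul (-1))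
  simpa [sub_eq_add_neg] using this

theorem congr (hf : Represents f T) (h : ∀ x ≠ 0, g x = f x) : Represents g T := by
  have hae : f =ᵐ[volume] g := by
    filter_upwards [Measure.ae_ne volume (0 : Plane)] with x hx using (h x hx).symm
  have hg := hf.1.congr hae
  refine ⟨hg, ?_⟩
  ext φ
  rw [regularDist_apply hg, hf.apply]
  exact integral_congr_ae (by filter_upwards [hae] with x hx; rw [hx])

/-- The distributional derivative of a function that is differentiable away from the origin, with
locally integrable derivative, is the pointwise one. -/
theorem pd {i : Fin 2} (hf : Represents f T) (hg : LocallyIntegrable g)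
    (h : ∀ x ≠ 0, HasLineDerivAt ℝ f (g x) x (unitVec i)) :
    Represents g (RelaxedMicromorphic.pd i T) := by
  refine ⟨hg, ?_⟩
  ext φ
  rw [regularDist_apply hg, pd_apply, hf.apply, eq_neg_iff_add_eq_zero,
    ← integral_add (integrable_testFunction_mul hg φ) (integrable_testFunction_mul hf.1 _)]
  -- By the product rule the integrand is the directional derivative of `φ f`.
  refine integral_lineDeriv_eq_zero (i := i) (integrable_testFunction_mul hf.1 φ)
    ((integrable_testFunction_mul hg φ).add (integrable_testFunction_mul hf.1 _)) fun x hx => ?_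
  have := HasDerivAt.mul (testFunction_hasLineDerivAt φ (unitVec i) x) (h x hx)
  simp only [zero_smul, add_zero] at this
  rw [add_comm]
  exact this

end Represents

/-! ### Constants, linearity and commutation of distributional derivatives. -/

theorem pd_regularDist_const (i : Fin 2) (a : ℝ) : pd i (regularDist fun _ => a) = 0 := by
  have h0 : LocallyIntegrable (fun _ : Plane => (0 : ℝ)) := locallyIntegrable_const 0
  have h := (Represents.of_locallyIntegrable (locallyIntegrable_const a)).pd (i := i) h0
    fun x _ => hasDerivAt_const _ _
  rw [← h.2]
  ext φ
  simp [regularDist_apply h0]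

/-- The partial derivative of distributions as a linear map. -/
noncomputable def pdLin (i : Fin 2) : PlaneDist →ₗ[ℝ] PlaneDist where
  toFun := pd i
  map_add' S T := LineDeriv.lineDerivOp_add (unitVec i) S T
  map_smul' a T := LineDeriv.lineDerivOp_smul (unitVec i) a T

/-- By duality this is the symmetry of the second derivative of a test function. -/
theorem pd_comm (i j : Fin 2) (T : PlaneDist) : pd i (pd j T) = pd j (pd i T) := by
  have key : ∀ (φ : 𝓓((⊤ : TopologicalSpace.Opens Plane), ℝ)) (v w : Plane),
      ∂_{v} (∂_{w} φ) = ∂_{w} (∂_{v} φ) := by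
    intro φ v w
    have hφ : Differentiable ℝ φ := φ.contDiff.differentiable (by simp)
    have hφ' : Differentiable ℝ (fderiv ℝ φ) :=
      (φ.contDiff.fderiv_right (m := 1) (by norm_cast)).differentiable (by simp)
    have h1 : ∀ v w x : Plane, (∂_{v} (∂_{w} φ)) x = fderiv ℝ (fderiv ℝ φ) x v w := by
      intro v w x
      have e : ⇑(∂_{w} φ : 𝓓((⊤ : TopologicalSpace.Opens Plane), ℝ)) = fun y => fderiv ℝ φ y w := by
        ext y
        rw [testFunction_lineDeriv_apply, (hφ y).lineDeriv_eq_fderiv]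
      rw [testFunction_lineDeriv_apply, e,
        ((hφ' x).clm_apply (differentiableAt_const w)).lineDeriv_eq_fderiv,
        fderiv_clm_apply (hφ' x) (differentiableAt_const w)]
      simp
    ext x
    rw [h1, h1]
    exact (φ.contDiff.contDiffAt.isSymmSndFDerivAt (by simp; norm_cast)).eq v w
  ext φ
  simp only [pd_apply, neg_neg, key φ (unitVec i) (unitVec j)]

/-! ### Local integrability at a point singularity -/

/-- The Jacobian `r` of the plane cancels the singularity. -/
theorem locallyIntegrable_inv_norm : LocallyIntegrable (fun x : Plane => ‖x‖⁻¹) := by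
  refine locallyIntegrable_iff.2 fun K hK => ?_
  obtain ⟨R, hR⟩ := hK.isBounded.subset_ball (0 : Plane)
  refine IntegrableOn.mono_set ?_ hR
  refine (integrableOn_fun_norm_addHaar volume (f := fun r : ℝ => r⁻¹)).2 ?_
  have : IntegrableOn (fun _ : ℝ => (1 : ℝ)) (Set.Ioo 0 R) := by simp
  refine this.congr_fun (fun r hr => ?_) measurableSet_Ioo
  simp [hr.1.ne']

theorem locallyIntegrable_of_isBigO {f : Plane → ℝ} (hf : ContinuousOn f {0}ᶜ)
    (h : f =O[𝓝[≠] 0] fun x => 1 / ‖x‖) : LocallyIntegrable f := by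
  have hm : AEStronglyMeasurable f volume := by
    have := hf.aestronglyMeasurable (μ := volume) (measurableSet_singleton (0 : Plane)).compl
    rwa [Measure.restrict_eq_self_of_ae_mem] at this
    filter_upwards [Measure.ae_ne volume (0 : Plane)] with x hx using hx
  intro x
  by_cases hx : x = 0
  · subst hx
    obtain ⟨C, hC⟩ := h.bound
    obtain ⟨δ, hδ, hC⟩ := Metric.mem_nhdsWithin_iff.1 hC
    obtain ⟨s, hs, hi⟩ := locallyIntegrable_inv_norm (0 : Plane)
    have hb : MeasurableSet (Metric.ball (0 : Plane) δ) := Metric.isOpen_ball.measurableSet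
    refine ⟨s ∩ Metric.ball 0 δ, inter_mem hs (Metric.ball_mem_nhds _ hδ), ?_⟩
    refine ((hi.mono_set Set.inter_subset_left).const_mul C).mono' hm.restrict ?_
    refine ae_restrict_of_ae_restrict_of_subset Set.inter_subset_right ?_
    rw [ae_restrict_iff' hb]
    filter_upwards [Measure.ae_ne volume (0 : Plane)] with x hx hxδ
    simpa using hC ⟨hxδ, hx⟩
  · have := hf.locallyIntegrableOn (μ := volume) (measurableSet_singleton (0 : Plane)).compl x hx
    rwa [isOpen_compl_singleton.nhdsWithin_eq (by simpa using hx)] at this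

/-! ### The Laplacian of the logarithm -/

/-- The unit vector of polar angle `θ`. -/
noncomputable def polarVec (θ : ℝ) : Plane := !₂[Real.cos θ, Real.sin θ]

theorem norm_polarVec (θ : ℝ) : ‖polarVec θ‖ = 1 := by
  simp [polarVec, EuclideanSpace.norm_eq]

theorem continuous_polarVec : Continuous polarVec := by
  refine (PiLp.continuous_toLp 2 _).comp (continuous_pi fun i => ?_)
  fin_cases i
  · exact Real.continuous_cos
  · exact Real.continuous_sin

theorem polarVec_eq (θ : ℝ) :
    polarVec θ = Real.cos θ • unitVec 0 + Real.sin θ • unitVec 1 := by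
  ext j
  fin_cases j <;> simp [polarVec, unitVec]

theorem integral_polar (F : Plane → ℝ) :
    ∫ x, F x = ∫ p in Set.Ioi (0 : ℝ) ×ˢ Set.Ioo (-Real.pi) Real.pi,
      p.1 * F (p.1 • polarVec p.2) := by
  rw [← (measurePreserving_planeEquiv 1).integral_comp (planeEquiv 1).measurableEmbedding,
    ← integral_comp_polarCoord_symm, polarCoord_target]
  refine setIntegral_congr_fun (measurableSet_Ioi.prod measurableSet_Ioo) fun p _ => ?_
  have : planeEquiv 1 (polarCoord.symm p) = p.1 • polarVec p.2 := by
    ext j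
    fin_cases j <;> simp [planeEquiv_one_apply, polarVec]
  simp only [this, smul_eq_mul]

/-- On each ray the integrand is the derivative of `φ` along the ray, which integrates to `-φ 0` by
compact support; the angle contributes the factor `2π`. -/
theorem integral_radial_fderiv {φ : Plane → ℝ} (hφ : ContDiff ℝ 1 φ)
    (hs : HasCompactSupport φ) :
    ∫ p in Set.Ioi (0 : ℝ) ×ˢ Set.Ioo (-Real.pi) Real.pi,
      fderiv ℝ φ (p.1 • polarVec p.2) (polarVec p.2) = -(2 * Real.pi * φ 0) := by
  obtain ⟨R, hR⟩ := hs.isCompact.isBounded.subset_ball (0 : Plane)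
  have hcont : Continuous fun p : ℝ × ℝ =>
      fderiv ℝ φ (p.1 • polarVec p.2) (polarVec p.2) := by
    have h2 : Continuous fun p : ℝ × ℝ => polarVec p.2 := continuous_polarVec.comp continuous_snd
    exact ((hφ.continuous_fderiv one_ne_zero).comp (continuous_fst.smul h2)).clm_apply h2
  have hint : IntegrableOn (fun p : ℝ × ℝ =>
      fderiv ℝ φ (p.1 • polarVec p.2) (polarVec p.2))
      (Set.Ioi (0 : ℝ) ×ˢ Set.Ioo (-Real.pi) Real.pi) (volume.prod volume) := by
    -- The integrand vanishes for radius beyond `R`, so integrability over the strip reduces to a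
    -- compact box.
    refine (hcont.continuousOn.integrableOn_compact
      ((isCompact_Icc (a := (0 : ℝ)) (b := R)).prod
        (isCompact_Icc (a := -Real.pi) (b := Real.pi)))).of_forall_sdiff_eq_zero
      (measurableSet_Ioi.prod measurableSet_Ioo) fun p hp => ?_
    have hpR : R < p.1 := by
      by_contra! h
      exact hp.2 ⟨⟨hp.1.1.le, h⟩, hp.1.2.1.le, hp.1.2.2.le⟩
    have : fderiv ℝ φ (p.1 • polarVec p.2) = 0 := by
      refine image_eq_zero_of_notMem_tsupport fun h => ?_
      have h' := hR (tsupport_fderiv_subset ℝ h)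
      rw [mem_ball_zero_iff, norm_smul, norm_polarVec, mul_one, Real.norm_eq_abs] at h'
      exact absurd (le_abs_self p.1) (by linarith)
    simp [this]
  have hray : ∀ θ : ℝ, ∫ r in Set.Ioi (0 : ℝ),
      fderiv ℝ φ (r • polarVec θ) (polarVec θ) = -φ 0 := by
    intro θ
    have hd : ∀ r : ℝ, HasDerivAt (fun r : ℝ => φ (r • polarVec θ))
        (fderiv ℝ φ (r • polarVec θ) (polarVec θ)) r := by
      intro r
      have h1 : HasDerivAt (fun r : ℝ => r • polarVec θ) (polarVec θ) r := by
        simpa using (hasDerivAt_id r).smul_const (polarVec θ)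
      exact ((hφ.differentiable one_ne_zero) _).hasFDerivAt.comp_hasDerivAt r h1
    have hc : HasCompactSupport fun r : ℝ => φ (r • polarVec θ) := by
      refine HasCompactSupport.of_support_subset_isCompact (isCompact_Icc (a := -R) (b := R)) ?_
      intro r hr
      have h' := hR (subset_tsupport _ hr)
      rw [mem_ball_zero_iff, norm_smul, norm_polarVec, mul_one, Real.norm_eq_abs, abs_lt] at h'
      exact ⟨h'.1.le, h'.2.le⟩
    have hC : ContDiff ℝ 1 fun r : ℝ => φ (r • polarVec θ) :=
      hφ.comp (contDiff_id.smul contDiff_const)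
    simpa [funext fun r => (hd r).deriv] using HasCompactSupport.integral_Ioi_deriv_eq hC hc 0
  rw [Measure.volume_eq_prod] at *
  rw [← Measure.prod_restrict, integral_prod_symm _ (by rwa [Measure.prod_restrict])]
  simp only [hray]
  rw [setIntegral_const, measureReal_def, Real.volume_Ioo,
    ENNReal.toReal_ofReal (by linarith [Real.pi_pos]), smul_eq_mul]
  ring

/-- Tested against `φ`, the left side is `-∫ ∇φ · x / r²`. In polar coordinates the Jacobian cancels
the remaining `1 / r` and only the radial derivative of `φ` is left. -/
theorem pd_coord_div_sq {T : Fin 2 → PlaneDist}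
    (hT : ∀ i, Represents (fun x => x i / ‖x‖ ^ 2) (T i)) :
    pd 0 (T 0) + pd 1 (T 1) = (2 * Real.pi) • Distribution.delta (0 : Plane) := by
  ext φ
  change pd 0 (T 0) φ + pd 1 (T 1) φ = 2 * Real.pi * φ 0
  rw [pd_apply, pd_apply, (hT 0).apply, (hT 1).apply, ← neg_add,
    ← integral_add (integrable_testFunction_mul (hT 0).1 _)
      (integrable_testFunction_mul (hT 1).1 _), integral_polar, neg_eq_iff_eq_neg,
    ← integral_radial_fderiv (φ.contDiff.of_le (by norm_cast)) φ.hasCompactSupport]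
  refine setIntegral_congr_fun (measurableSet_Ioi.prod measurableSet_Ioo) fun p hp => ?_
  have hp0 : p.1 ≠ 0 := (ne_of_gt hp.1)
  have hd := φ.contDiff.differentiable (by simp) (p.1 • polarVec p.2)
  simp only [testFunction_lineDeriv_apply, hd.lineDeriv_eq_fderiv, norm_smul, norm_polarVec]
  have hmap : ∀ A : Plane →L[ℝ] ℝ, A (polarVec p.2) =
      Real.cos p.2 * A (unitVec 0) + Real.sin p.2 * A (unitVec 1) := by
    intro A
    conv_lhs => rw [polarVec_eq]
    simp
  have h0 : polarVec p.2 0 = Real.cos p.2 := rfl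
  have h1 : polarVec p.2 1 = Real.sin p.2 := rfl
  simp only [hmap, PiLp.smul_apply, smul_eq_mul, h0, h1, Real.norm_eq_abs, mul_one, sq_abs]
  field_simp

/-! ### Modified Bessel functions of the second kind -/

/-- The moments `∫₀^∞ cosh(t)^k exp (-z cosh t) dt`. -/
noncomputable def coshMoment (k : ℕ) (z : ℝ) : ℝ :=
  ∫ t in Set.Ioi (0 : ℝ), Real.cosh t ^ k * Real.exp (-z * Real.cosh t)

theorem le_cosh {t : ℝ} (ht : 0 ≤ t) : t ≤ Real.cosh t :=
  (Real.self_le_sinh_iff.2 ht).trans (Real.sinh_lt_cosh t).le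

/-- Half of the exponential absorbs the power, by `xᵏ / k! ≤ exp x` at `x = (z / 2) cosh t`; the
other half decays because `cosh t ≥ t`. -/
theorem cosh_pow_mul_exp_le (k : ℕ) {z t : ℝ} (hz : 0 < z) (ht : 0 ≤ t) :
    Real.cosh t ^ k * Real.exp (-z * Real.cosh t) ≤
      (k.factorial * (2 / z) ^ k) * Real.exp (-(z / 2) * t) := by
  have h1 := Real.pow_div_factorial_le_exp (z / 2 * Real.cosh t)
    (by have := Real.cosh_pos t; positivity) k
  have hk : (0 : ℝ) < k.factorial := by positivity
  have h2 : Real.cosh t ^ k ≤ (k.factorial * (2 / z) ^ k) * Real.exp (z / 2 * Real.cosh t) := by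
    rw [div_le_iff₀ hk, mul_pow] at h1
    have h3 := mul_le_mul_of_nonneg_left h1 (show 0 ≤ (2 / z) ^ k by positivity)
    rw [← mul_assoc, ← mul_pow, div_mul_div_comm, mul_comm 2 z, div_self (by positivity),
      one_pow, one_mul] at h3
    linarith
  calc Real.cosh t ^ k * Real.exp (-z * Real.cosh t)
      ≤ (k.factorial * (2 / z) ^ k) * Real.exp (z / 2 * Real.cosh t)
          * Real.exp (-z * Real.cosh t) := by gcongr
    _ = (k.factorial * (2 / z) ^ k) * Real.exp (-(z / 2) * Real.cosh t) := by
        rw [mul_assoc, ← Real.exp_add]; ring_nf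
    _ ≤ _ := by
        have := le_cosh ht
        have : -(z / 2) * Real.cosh t ≤ -(z / 2) * t := by nlinarith
        gcongr

theorem integrableOn_exp_neg_mul {z : ℝ} (hz : 0 < z) :
    IntegrableOn (fun t => Real.exp (-z * t)) (Set.Ioi 0) :=
  integrableOn_exp_mul_Ioi (by linarith) 0

theorem integral_exp_neg_mul {z : ℝ} (hz : 0 < z) :
    ∫ t in Set.Ioi (0 : ℝ), Real.exp (-z * t) = 1 / z := by
  rw [integral_exp_mul_Ioi (by linarith)]
  simp

theorem integrableOn_coshMoment (k : ℕ) {z : ℝ} (hz : 0 < z) :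
    IntegrableOn (fun t => Real.cosh t ^ k * Real.exp (-z * Real.cosh t)) (Set.Ioi 0) := by
  refine ((integrableOn_exp_neg_mul (half_pos hz)).const_mul
    (k.factorial * (2 / z) ^ k)).mono' (by fun_prop) ?_
  filter_upwards [ae_restrict_mem measurableSet_Ioi] with t ht
  have := Real.cosh_pos t
  rw [Real.norm_of_nonneg (by positivity)]
  exact cosh_pow_mul_exp_le k hz (le_of_lt ht)

theorem hasDerivAt_coshMoment (k : ℕ) {z : ℝ} (hz : 0 < z) :
    HasDerivAt (coshMoment k) (-coshMoment (k + 1) z) z := by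
  -- On this neighbourhood the differentiated integrand is dominated by its absolute value at `z /
  -- 2`, a moment integrand of order `k + 1`.
  have hs : Set.Ioi (z / 2) ∈ 𝓝 z := Ioi_mem_nhds (by linarith)
  have key := (hasDerivAt_integral_of_dominated_loc_of_deriv_le
    (μ := volume.restrict (Set.Ioi (0 : ℝ)))
    (F := fun z t => Real.cosh t ^ k * Real.exp (-z * Real.cosh t))
    (F' := fun z t => -(Real.cosh t ^ (k + 1) * Real.exp (-z * Real.cosh t)))
    (bound := fun t => Real.cosh t ^ (k + 1) * Real.exp (-(z / 2) * Real.cosh t)) (x₀ := z) hs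
    (Eventually.of_forall fun y => by fun_prop) (integrableOn_coshMoment k hz) (by fun_prop)
    (Eventually.of_forall fun t y hy => ?_) (integrableOn_coshMoment (k + 1) (half_pos hz))
    (Eventually.of_forall fun t y _ => ?_)).2
  · rwa [integral_neg] at key
  · have hc := Real.cosh_pos t
    rw [norm_neg, Real.norm_of_nonneg (by positivity)]
    have : -y * Real.cosh t ≤ -(z / 2) * Real.cosh t := by
      have : z / 2 < y := hy
      nlinarith
    gcongr
  · have h := (((hasDerivAt_id y).neg.mul_const (Real.cosh t)).exp).const_mul (Real.cosh t ^ k)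
    refine h.congr_deriv ?_
    simp
    ring

theorem coshMoment_nonneg (k : ℕ) (z : ℝ) : 0 ≤ coshMoment k z :=
  setIntegral_nonneg measurableSet_Ioi fun t _ => by
    have := Real.cosh_pos t
    positivity

/-- Integrate the derivative of `sinh t · exp (-z cosh t)`, whose boundary values vanish, and use
`sinh² = cosh² - 1`. This recurrence is what closes the derivatives of `K₀` and `K₁` on themselves.
-/
theorem coshMoment_two {z : ℝ} (hz : 0 < z) :
    coshMoment 2 z = coshMoment 0 z + coshMoment 1 z / z := by
  have hd : ∀ t ∈ Set.Ioi (0 : ℝ),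
      HasDerivAt (fun t => Real.sinh t * Real.exp (-z * Real.cosh t))
        (Real.cosh t ^ 1 * Real.exp (-z * Real.cosh t)
          - z * (Real.cosh t ^ 2 * Real.exp (-z * Real.cosh t)
            - Real.cosh t ^ 0 * Real.exp (-z * Real.cosh t))) t := by
    intro t _
    have h := (Real.hasDerivAt_sinh t).mul (((Real.hasDerivAt_cosh t).const_mul (-z)).exp)
    refine h.congr_deriv ?_
    rw [Real.cosh_sq]
    ring
  have hi' : IntegrableOn (fun t => z * (Real.cosh t ^ 2 * Real.exp (-z * Real.cosh t)
      - Real.cosh t ^ 0 * Real.exp (-z * Real.cosh t))) (Set.Ioi 0) :=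
    ((integrableOn_coshMoment 2 hz).sub (integrableOn_coshMoment 0 hz)).const_mul z
  have hi := (integrableOn_coshMoment 1 hz).sub hi'
  have hlim : Tendsto (fun t => Real.sinh t * Real.exp (-z * Real.cosh t)) atTop (𝓝 0) := by
    have h0 : Tendsto (fun t => ((1 : ℕ).factorial * (2 / z) ^ 1) * Real.exp (-(z / 2) * t))
        atTop (𝓝 0) := by
      have : Tendsto (fun t => Real.exp (-(z / 2) * t)) atTop (𝓝 0) :=
        Real.tendsto_exp_atBot.comp (tendsto_id.const_mul_atTop_of_neg (by linarith))
      simpa only [mul_zero] using this.const_mul ((1 : ℕ).factorial * (2 / z) ^ 1)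
    refine squeeze_zero' ?_ ?_ h0
    · filter_upwards [eventually_ge_atTop 0] with t ht
      have := Real.sinh_nonneg_iff.2 ht
      positivity
    · filter_upwards [eventually_ge_atTop 0] with t ht
      refine le_trans ?_ (cosh_pow_mul_exp_le 1 hz ht)
      rw [pow_one]
      have := (Real.sinh_lt_cosh t).le
      gcongr
  have h := integral_Ioi_of_hasDerivAt_of_tendsto (Continuous.continuousWithinAt (by fun_prop))
    hd hi hlim
  rw [integral_sub (integrableOn_coshMoment 1 hz) hi',
    integral_const_mul, integral_sub (integrableOn_coshMoment 2 hz)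
    (integrableOn_coshMoment 0 hz), Real.sinh_zero, zero_mul, sub_zero] at h
  change coshMoment 1 z - z * (coshMoment 2 z - coshMoment 0 z) = 0 at h
  field_simp
  linarith

theorem besselK_zero (z : ℝ) : besselK 0 z = coshMoment 0 z := by
  simp [besselK, coshMoment]

theorem besselK_one (z : ℝ) : besselK 1 z = coshMoment 1 z := by
  simp [besselK, coshMoment, mul_comm]

theorem besselK_zero_nonneg (z : ℝ) : 0 ≤ besselK 0 z := besselK_zero z ▸ coshMoment_nonneg 0 z

theorem besselK_one_nonneg (z : ℝ) : 0 ≤ besselK 1 z := besselK_one z ▸ coshMoment_nonneg 1 z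

theorem besselK_two {z : ℝ} (hz : 0 < z) :
    besselK 2 z = besselK 0 z + 2 * besselK 1 z / z := by
  have : besselK 2 z = 2 * coshMoment 2 z - coshMoment 0 z := by
    rw [besselK, coshMoment, coshMoment, ← integral_const_mul,
      ← integral_sub ((integrableOn_coshMoment 2 hz).const_mul 2) (integrableOn_coshMoment 0 hz)]
    refine integral_congr_ae (Eventually.of_forall fun t => ?_)
    simp only [Nat.cast_ofNat, Real.cosh_two_mul, Real.sinh_sq]
    ring
  rw [this, coshMoment_two hz, besselK_zero, besselK_one]
  ring

theorem hasDerivAt_besselK_zero {z : ℝ} (hz : 0 < z) :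
    HasDerivAt (besselK 0) (-besselK 1 z) z := by
  rw [funext besselK_zero, besselK_one]
  exact hasDerivAt_coshMoment 0 hz

theorem hasDerivAt_besselK_one {z : ℝ} (hz : 0 < z) :
    HasDerivAt (besselK 1) (-(besselK 0 z + besselK 1 z / z)) z := by
  rw [funext besselK_one, besselK_zero, ← coshMoment_two hz]
  exact hasDerivAt_coshMoment 1 hz

theorem besselK_zero_le {z : ℝ} (hz : 0 < z) : besselK 0 z ≤ 1 / z := by
  rw [← integral_exp_neg_mul hz, besselK_zero, coshMoment]
  refine setIntegral_mono_on (integrableOn_coshMoment 0 hz) (integrableOn_exp_neg_mul hz)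
    measurableSet_Ioi fun t ht => ?_
  have := le_cosh (le_of_lt ht)
  rw [pow_zero, one_mul]
  exact Real.exp_le_exp.2 (by nlinarith)

/-- An exactly integrable comparison function: it differs from the integrand of `z K₁(z)` only by
`sinh` in place of `cosh` in the exponent. -/
theorem integral_cosh_mul_exp_neg_sinh {z : ℝ} (hz : 0 < z) :
    IntegrableOn (fun t => z * Real.cosh t * Real.exp (-z * Real.sinh t)) (Set.Ioi 0) ∧
      ∫ t in Set.Ioi (0 : ℝ), z * Real.cosh t * Real.exp (-z * Real.sinh t) = 1 := by
  have hd : ∀ t ∈ Set.Ioi (0 : ℝ), HasDerivAt (fun t => -Real.exp (-z * Real.sinh t))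
      (z * Real.cosh t * Real.exp (-z * Real.sinh t)) t := by
    intro t _
    have h := (((Real.hasDerivAt_sinh t).const_mul (-z)).exp).neg
    refine h.congr_deriv ?_
    ring
  have hlim : Tendsto (fun t => -Real.exp (-z * Real.sinh t)) atTop (𝓝 (-0)) := by
    have hs : Tendsto Real.sinh atTop atTop :=
      tendsto_atTop_mono' _ ((eventually_ge_atTop 0).mono fun t ht =>
        Real.self_le_sinh_iff.2 ht) tendsto_id
    exact (Real.tendsto_exp_atBot.comp (hs.const_mul_atTop_of_neg (by linarith))).neg
  have hc : ContinuousWithinAt (fun t => -Real.exp (-z * Real.sinh t)) (Set.Ici 0) 0 :=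
    Continuous.continuousWithinAt (by fun_prop)
  have hpos : ∀ t ∈ Set.Ioi (0 : ℝ), 0 ≤ z * Real.cosh t * Real.exp (-z * Real.sinh t) :=
    fun t _ => by have := Real.cosh_pos t; positivity
  refine ⟨integrableOn_Ioi_deriv_of_nonneg hc hd hpos hlim, ?_⟩
  rw [integral_Ioi_of_hasDerivAt_of_nonneg hc hd hpos hlim]
  simp

theorem mul_besselK_one_eq (z : ℝ) :
    z * besselK 1 z =
      ∫ t in Set.Ioi (0 : ℝ), z * (Real.cosh t ^ 1 * Real.exp (-z * Real.cosh t)) := by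
  rw [integral_const_mul, besselK_one, coshMoment]

theorem mul_besselK_one_le_one {z : ℝ} (hz : 0 < z) : z * besselK 1 z ≤ 1 := by
  rw [mul_besselK_one_eq, ← (integral_cosh_mul_exp_neg_sinh hz).2]
  refine setIntegral_mono_on ((integrableOn_coshMoment 1 hz).const_mul z)
    (integral_cosh_mul_exp_neg_sinh hz).1 measurableSet_Ioi fun t _ => ?_
  have h1 := Real.cosh_pos t
  have h2 : -z * Real.cosh t ≤ -z * Real.sinh t := by nlinarith [Real.sinh_lt_cosh t]
  rw [pow_one, ← mul_assoc]
  gcongr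

/-- Both sides are written as integrals and compared pointwise, with `1` as the integral of the
comparison function and `z` as that of `z² exp (-z t)`. The gain comes from `1 - exp (-s) ≤ s` with
`s = z (cosh t - sinh t)`. -/
theorem one_sub_mul_besselK_one_le {z : ℝ} (hz : 0 < z) : 1 - z * besselK 1 z ≤ z := by
  have hi := integrableOn_coshMoment 1 hz
  have hz' : z = ∫ t in Set.Ioi (0 : ℝ), z ^ 2 * Real.exp (-z * t) := by
    rw [integral_const_mul, integral_exp_neg_mul hz]
    field_simp
  conv_rhs => rw [hz']
  rw [mul_besselK_one_eq]
  conv_lhs => rw [← (integral_cosh_mul_exp_neg_sinh hz).2]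
  rw [← integral_sub (integral_cosh_mul_exp_neg_sinh hz).1 (hi.const_mul z)]
  refine setIntegral_mono_on ((integral_cosh_mul_exp_neg_sinh hz).1.sub (hi.const_mul z))
    ((integrableOn_exp_neg_mul hz).const_mul _) measurableSet_Ioi fun t ht => ?_
  have ht0 : 0 ≤ t := le_of_lt ht
  have hcs : Real.cosh t * (Real.cosh t - Real.sinh t) ≤ 1 := by
    nlinarith [Real.cosh_sq t, Real.sinh_nonneg_iff.2 ht0, Real.sinh_lt_cosh t]
  have hsum : -z * Real.cosh t = -z * Real.sinh t + -(z * (Real.cosh t - Real.sinh t)) := by ring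
  have h1 := Real.one_sub_le_exp_neg (z * (Real.cosh t - Real.sinh t))
  have hc := Real.cosh_pos t
  calc z * Real.cosh t * Real.exp (-z * Real.sinh t)
        - z * (Real.cosh t ^ 1 * Real.exp (-z * Real.cosh t))
      = z * Real.cosh t * Real.exp (-z * Real.sinh t)
          * (1 - Real.exp (-(z * (Real.cosh t - Real.sinh t)))) := by
        rw [hsum, Real.exp_add]; ring
    _ ≤ z * Real.cosh t * Real.exp (-z * Real.sinh t)
          * (z * (Real.cosh t - Real.sinh t)) := by
        gcongr
        linarith
    _ = z ^ 2 * Real.exp (-z * Real.sinh t)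
          * (Real.cosh t * (Real.cosh t - Real.sinh t)) := by ring
    _ ≤ z ^ 2 * Real.exp (-z * Real.sinh t) * 1 := by gcongr
    _ ≤ z ^ 2 * Real.exp (-z * t) := by
        rw [mul_one]
        have : -z * Real.sinh t ≤ -z * t := by nlinarith [Real.self_le_sinh_iff.2 ht0]
        gcongr

theorem nonneg_of_deriv_nonneg_of_tendsto {f f' : ℝ → ℝ} (hd : ∀ z > 0, HasDerivAt f (f' z) z)
    (hf' : ∀ z > 0, 0 ≤ f' z) (h0 : Tendsto f (𝓝[>] 0) (𝓝 0)) {z : ℝ} (hz : 0 < z) :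
    0 ≤ f z := by
  have hm : MonotoneOn f (Set.Ioi 0) := by
    refine monotoneOn_of_deriv_nonneg (convex_Ioi 0)
      (fun x hx => (hd x hx).continuousAt.continuousWithinAt) ?_ ?_ <;> rw [interior_Ioi]
    · exact fun x hx => (hd x hx).differentiableAt.differentiableWithinAt
    · exact fun x hx => (hd x hx).deriv ▸ hf' x hx
  refine le_of_tendsto h0 ?_
  filter_upwards [Ioo_mem_nhdsGT hz] with s hs
  exact hm hs.1 hz hs.2.le

/-- The function is `z² (2 / z² - K₂(z))` after the recurrence for `K₂`; all terms of its derivative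
but one cancel, and the survivor has a sign. -/
theorem hasDerivAt_sq_mul_phi {z : ℝ} (hz : 0 < z) :
    HasDerivAt (fun z => 2 - 2 * (z * besselK 1 z) - z ^ 2 * besselK 0 z)
      (z ^ 2 * besselK 1 z) z := by
  have h := (((hasDerivAt_id z).mul (hasDerivAt_besselK_one hz)).const_mul 2).const_sub 2 |>.sub
    ((hasDerivAt_pow 2 z).mul (hasDerivAt_besselK_zero hz))
  refine h.congr_deriv ?_
  simp
  field_simp
  ring

/-- The function vanishes at `0+` and its derivative `z² K₁(z)` lies between `0` and `z`, since `z
K₁(z) ≤ 1`. -/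
theorem sq_mul_phi_bounds {z : ℝ} (hz : 0 < z) :
    0 ≤ 2 - 2 * (z * besselK 1 z) - z ^ 2 * besselK 0 z ∧
      2 - 2 * (z * besselK 1 z) - z ^ 2 * besselK 0 z ≤ z ^ 2 / 2 := by
  have hlim : Tendsto (fun z => 2 - 2 * (z * besselK 1 z) - z ^ 2 * besselK 0 z) (𝓝[>] 0)
      (𝓝 0) := by
    have h3 : Tendsto (fun z : ℝ => 2 * z) (𝓝[>] 0) (𝓝 0) :=
      tendsto_nhdsWithin_of_tendsto_nhds (Continuous.tendsto' (by fun_prop) _ _ (by simp))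
    refine squeeze_zero_norm' ?_ h3
    filter_upwards [self_mem_nhdsWithin] with s hs
    have hs : 0 < s := hs
    have h1 := one_sub_mul_besselK_one_le hs
    have h2 := mul_besselK_one_le_one hs
    have h4 : s ^ 2 * besselK 0 s ≤ s := by
      have := mul_le_mul_of_nonneg_left (besselK_zero_le hs) (sq_nonneg s)
      rwa [show s ^ 2 * (1 / s) = s by field_simp] at this
    have h5 : 0 ≤ s ^ 2 * besselK 0 s := mul_nonneg (sq_nonneg s) (besselK_zero_nonneg s)
    rw [Real.norm_eq_abs, abs_le]
    constructor <;> linarith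
  refine ⟨nonneg_of_deriv_nonneg_of_tendsto (fun z hz => hasDerivAt_sq_mul_phi hz)
    (fun z _ => mul_nonneg (sq_nonneg z) (besselK_one_nonneg z)) hlim hz, ?_⟩
  have h0 : Tendsto (fun z : ℝ => z ^ 2 / 2) (𝓝[>] 0) (𝓝 0) :=
    tendsto_nhdsWithin_of_tendsto_nhds (Continuous.tendsto' (by fun_prop) _ _ (by simp))
  have := nonneg_of_deriv_nonneg_of_tendsto
    (fun z hz => (((hasDerivAt_pow 2 z).div_const 2).sub (hasDerivAt_sq_mul_phi hz)))
    (fun z hz => ?_) (by have := h0.sub hlim; rwa [sub_zero] at this) hz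
  · simp only [Pi.sub_apply] at this
    linarith
  · have := mul_le_mul_of_nonneg_left (mul_besselK_one_le_one hz) (le_of_lt hz)
    simp
    nlinarith

/-- The derivative `(1 - z K₁(z)) / z` lies in `[0, 1]`, so both `K₀ + log` and `z - (K₀ + log)` are
monotone; compare with their values at `1`. -/
theorem besselK_zero_add_log_bounds {z : ℝ} (hz : 0 < z) (hz1 : z ≤ 1) :
    |besselK 0 z + Real.log z| ≤ |besselK 0 1| + 1 := by
  have hd : ∀ z > 0, HasDerivAt (fun z => besselK 0 z + Real.log z)
      ((1 - z * besselK 1 z) / z) z := by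
    intro z hz
    refine ((hasDerivAt_besselK_zero hz).add (Real.hasDerivAt_log hz.ne')).congr_deriv ?_
    field_simp
    ring
  have hm : MonotoneOn (fun z => besselK 0 z + Real.log z) (Set.Ioi 0) := by
    refine monotoneOn_of_deriv_nonneg (convex_Ioi 0)
      (fun x hx => (hd x hx).continuousAt.continuousWithinAt) ?_ ?_ <;> rw [interior_Ioi]
    · exact fun x hx => (hd x hx).differentiableAt.differentiableWithinAt
    · intro x hx
      rw [(hd x hx).deriv]
      exact div_nonneg (by linarith [mul_besselK_one_le_one hx]) (le_of_lt hx)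
  have hm' : MonotoneOn (fun z => z - (besselK 0 z + Real.log z)) (Set.Ioi 0) := by
    have hd' : ∀ z > 0, HasDerivAt (fun z => z - (besselK 0 z + Real.log z))
        (1 - (1 - z * besselK 1 z) / z) z := fun z hz => (hasDerivAt_id z).sub (hd z hz)
    refine monotoneOn_of_deriv_nonneg (convex_Ioi 0)
      (fun x hx => (hd' x hx).continuousAt.continuousWithinAt) ?_ ?_ <;> rw [interior_Ioi]
    · exact fun x hx => (hd' x hx).differentiableAt.differentiableWithinAt
    · intro x hx
      rw [(hd' x hx).deriv, sub_nonneg, div_le_one hx]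
      exact one_sub_mul_besselK_one_le hx
  have h1 := hm hz (Set.mem_Ioi.2 one_pos) hz1
  have h2 := hm' hz (Set.mem_Ioi.2 one_pos) hz1
  simp only [Real.log_one, add_zero] at h1 h2
  rw [abs_le]
  have := abs_le.1 (le_refl |besselK 0 1|)
  constructor <;> linarith

/-! ### Radial profiles -/

theorem Psi_eq (l r : ℝ) : Psi l r = (1 - r / l * besselK 1 (r / l)) / r := by
  rw [Psi, one_div_mul_eq_div]

/-- The recurrence for `K₂` in terms of the profiles; it removes `K₂` and later converts between
`K₀`, `Φ` and `Ψ`. -/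
theorem Phi_eq {l r : ℝ} (hl : 0 < l) (hr : 0 < r) :
    Phi l r = 2 * l ^ 2 / r * Psi l r - besselK 0 (r / l) := by
  rw [Phi, Psi_eq, besselK_two (div_pos hr hl)]
  field_simp
  ring

theorem Psi_bounds {l r : ℝ} (hl : 0 < l) (hr : 0 < r) : 0 ≤ Psi l r ∧ Psi l r ≤ 1 / l := by
  have hz := div_pos hr hl
  rw [Psi_eq]
  refine ⟨div_nonneg (by linarith [mul_besselK_one_le_one hz]) hr.le, ?_⟩
  rw [div_le_iff₀ hr, one_div_mul_eq_div]
  exact one_sub_mul_besselK_one_le hz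

theorem Phi_bounds {l r : ℝ} (hl : 0 < l) (hr : 0 < r) : 0 ≤ Phi l r ∧ Phi l r ≤ 1 / 2 := by
  have hz := div_pos hr hl
  obtain ⟨h1, h2⟩ := sq_mul_phi_bounds hz
  have h3 : Phi l r = (2 - 2 * (r / l * besselK 1 (r / l)) - (r / l) ^ 2 * besselK 0 (r / l))
      / (r / l) ^ 2 := by
    rw [Phi, besselK_two hz]
    field_simp
    ring
  rw [h3]
  refine ⟨div_nonneg h1 (by positivity), ?_⟩
  rw [div_le_iff₀ (by positivity)]
  linarith

/-- The derivative of `Phi l`. -/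
noncomputable def PhiDeriv (l r : ℝ) : ℝ := besselK 1 (r / l) / l - 2 * Phi l r / r

/-- A difference of two quantities that both lie in `[0, 1 / r]`. -/
theorem abs_PhiDeriv_le {l r : ℝ} (hl : 0 < l) (hr : 0 < r) : |PhiDeriv l r| ≤ 1 / r := by
  have hz := div_pos hr hl
  obtain ⟨h1, h2⟩ := Phi_bounds hl hr
  have h3 : besselK 1 (r / l) / l ≤ 1 / r := by
    rw [le_div_iff₀ hr]
    have := mul_besselK_one_le_one hz
    calc _ = r / l * besselK 1 (r / l) := by ring
      _ ≤ 1 := this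
  have h4 : 0 ≤ besselK 1 (r / l) / l := div_nonneg (besselK_one_nonneg _) hl.le
  have h5 : 2 * Phi l r / r ≤ 1 / r := by gcongr; linarith
  have h6 : 0 ≤ 2 * Phi l r / r := by positivity
  rw [PhiDeriv, abs_le]
  constructor <;> linarith

theorem hasDerivAt_besselK_zero_div {l r : ℝ} (hl : 0 < l) (hr : 0 < r) :
    HasDerivAt (fun r => besselK 0 (r / l)) (-(besselK 1 (r / l) / l)) r := by
  have := HasDerivAt.comp (h₂ := besselK 0) (h := fun r => r / l) r (hasDerivAt_besselK_zero (div_pos hr hl))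
    ((hasDerivAt_id r).div_const l)
  refine this.congr_deriv ?_
  ring

theorem hasDerivAt_besselK_one_div {l r : ℝ} (hl : 0 < l) (hr : 0 < r) :
    HasDerivAt (fun r => besselK 1 (r / l)) (-(besselK 0 (r / l) / l + besselK 1 (r / l) / r))
      r := by
  have := HasDerivAt.comp (h₂ := besselK 1) (h := fun r => r / l) r (hasDerivAt_besselK_one (div_pos hr hl))
    ((hasDerivAt_id r).div_const l)
  refine this.congr_deriv ?_
  field_simp

theorem hasDerivAt_Psi_div {l r : ℝ} (hl : 0 < l) (hr : 0 < r) :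
    HasDerivAt (fun r => Psi l r / r) (r * (-Phi l r / (l ^ 2 * r ^ 2))) r := by
  have h1 : HasDerivAt (fun r => (1 - r / l * besselK 1 (r / l)) / r ^ 2)
      (((-(1 / l * besselK 1 (r / l)
          + r / l * -(besselK 0 (r / l) / l + besselK 1 (r / l) / r))) * r ^ 2
        - (1 - r / l * besselK 1 (r / l)) * (2 * r)) / (r ^ 2) ^ 2) r := by
    have := ((((hasDerivAt_id r).div_const l).mul (hasDerivAt_besselK_one_div hl hr)).const_sub
      1).div (hasDerivAt_pow 2 r) (by positivity)
    refine this.congr_deriv ?_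
    simp
  have h2 : (fun r => Psi l r / r) = fun r => (1 - r / l * besselK 1 (r / l)) / r ^ 2 := by
    ext s
    rw [Psi_eq, div_div, sq]
  rw [h2]
  refine h1.congr_deriv ?_
  rw [Phi_eq hl hr, Psi_eq]
  field_simp
  ring

theorem hasDerivAt_Phi {l r : ℝ} (hl : 0 < l) (hr : 0 < r) :
    HasDerivAt (Phi l) (PhiDeriv l r) r := by
  have h1 := (((hasDerivAt_Psi_div hl hr).const_mul (2 * l ^ 2)).sub
    (hasDerivAt_besselK_zero_div hl hr))
  refine (h1.congr_of_eventuallyEq ?_).congr_deriv ?_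
  · filter_upwards [Ioi_mem_nhds hr] with s hs
    rw [Phi_eq hl hs]
    simp
    ring
  · rw [PhiDeriv]
    field_simp
    ring

theorem continuousOn_Phi {l : ℝ} (hl : 0 < l) : ContinuousOn (Phi l) (Set.Ioi 0) :=
  fun _ hr => (hasDerivAt_Phi hl hr).continuousAt.continuousWithinAt

theorem continuousOn_Psi {l : ℝ} (hl : 0 < l) : ContinuousOn (fun r => Psi l r / r) (Set.Ioi 0) :=
  fun _ hr => (hasDerivAt_Psi_div hl hr).continuousAt.continuousWithinAt

theorem continuousOn_PhiDeriv {l : ℝ} (hl : 0 < l) : ContinuousOn (PhiDeriv l) (Set.Ioi 0) := by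
  refine ContinuousOn.sub (ContinuousOn.div_const (fun r hr => ?_) l)
    (((continuousOn_Phi hl).const_mul 2).div continuousOn_id fun r hr => ne_of_gt hr)
  exact (hasDerivAt_besselK_one_div hl hr).continuousAt.continuousWithinAt

/-! ### Radial functions on the plane -/

theorem norm_sq_eq (x : Plane) : ‖x‖ ^ 2 = x 0 ^ 2 + x 1 ^ 2 := by
  simp [EuclideanSpace.norm_sq_eq]

theorem abs_coord_le (x : Plane) (i : Fin 2) : |x i| ≤ ‖x‖ := PiLp.norm_apply_le x i

theorem hasLineDerivAt_coord (x : Plane) (i j : Fin 2) :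
    HasLineDerivAt ℝ (fun y : Plane => y i) (if i = j then 1 else 0) x (unitVec j) := by
  have h : HasDerivAt (fun t : ℝ => x i + t * (if i = j then 1 else 0))
      (if i = j then 1 else 0) 0 := by
    simpa using ((hasDerivAt_id (0 : ℝ)).mul_const (if i = j then (1 : ℝ) else 0)).const_add (x i)
  refine h.congr_of_eventuallyEq (Eventually.of_forall fun t => ?_)
  simp [unitVec]

theorem hasLineDerivAt_norm {x : Plane} (hx : x ≠ 0) (j : Fin 2) :
    HasLineDerivAt ℝ (fun y : Plane => ‖y‖) (x j / ‖x‖) x (unitVec j) := by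
  have h : HasLineDerivAt ℝ (fun y : Plane => ‖y‖ ^ 2) (2 * x j) x (unitVec j) := by
    simp only [norm_sq_eq]
    have h := ((HasDerivAt.pow (hasLineDerivAt_coord x 0 j) 2).add
      (HasDerivAt.pow (hasLineDerivAt_coord x 1 j) 2))
    refine HasDerivAt.congr_deriv h ?_
    fin_cases j <;> simp
  have hn : ‖x + (0 : ℝ) • unitVec j‖ ^ 2 ≠ 0 := by simpa using hx
  have h2 := HasDerivAt.sqrt h hn
  refine HasDerivAt.congr_deriv (h2.congr_of_eventuallyEq
    (Eventually.of_forall fun t => (Real.sqrt_sq (norm_nonneg _)).symm)) ?_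
  simp [Real.sqrt_sq (norm_nonneg x)]
  field_simp

theorem hasLineDerivAt_radial {g : ℝ → ℝ} {g' : ℝ} {x : Plane} (hx : x ≠ 0)
    (hg : HasDerivAt g g' ‖x‖) (j : Fin 2) :
    HasLineDerivAt ℝ (fun y : Plane => g ‖y‖) (g' * (x j / ‖x‖)) x (unitVec j) := by
  refine HasDerivAt.comp (h₂ := g) (0 : ℝ) ?_ (hasLineDerivAt_norm hx j)
  simpa using hg

theorem dPhi_eq {l : ℝ} (hl : 0 < l) {x : Plane} (hx : x ≠ 0) (i : Fin 2) :
    dPhi l i x = PhiDeriv l ‖x‖ * (x i / ‖x‖) :=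
  (hasLineDerivAt_radial hx (hasDerivAt_Phi hl (norm_pos_iff.2 hx)) i).lineDeriv

theorem hasLineDerivAt_mul {f g : Plane → ℝ} {f' g' : ℝ} {x v : Plane}
    (hf : HasLineDerivAt ℝ f f' x v) (hg : HasLineDerivAt ℝ g g' x v) :
    HasLineDerivAt ℝ (fun y => f y * g y) (f' * g x + f x * g') x v := by
  have := HasDerivAt.mul hf hg
  simp only [zero_smul, add_zero] at this
  exact this

theorem continuousOn_radial {g : ℝ → ℝ} (hg : ContinuousOn g (Set.Ioi 0)) :
    ContinuousOn (fun x : Plane => g ‖x‖) {0}ᶜ :=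
  hg.comp continuous_norm.continuousOn fun _ hx => norm_pos_iff.2 hx

theorem continuousOn_coord (i : Fin 2) (s : Set Plane) : ContinuousOn (fun x : Plane => x i) s :=
  (PiLp.continuous_apply 2 _ i).continuousOn

theorem isBigO_one_div_norm {f : Plane → ℝ} {C : ℝ}
    (h : ∀ x : Plane, x ≠ 0 → ‖x‖ ≤ 1 → |f x| ≤ C / ‖x‖) :
    f =O[𝓝[≠] 0] fun x => 1 / ‖x‖ := by
  refine IsBigO.of_bound C ?_
  filter_upwards [self_mem_nhdsWithin, mem_nhdsWithin_of_mem_nhds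
    (Metric.closedBall_mem_nhds (0 : Plane) one_pos)] with x hx h1
  simpa [div_eq_mul_inv] using h x hx (by simpa using h1)

/-- A function on the punctured plane that is continuous and `O(1 / r)` at the origin. -/
structure Tame (f : Plane → ℝ) : Prop where
  continuousOn : ContinuousOn f {0}ᶜ
  isBigO : f =O[𝓝[≠] 0] fun x => 1 / ‖x‖

theorem Tame.locallyIntegrable {f : Plane → ℝ} (h : Tame f) : LocallyIntegrable f :=
  locallyIntegrable_of_isBigO h.1 h.2

theorem Tame.of_bound {f : Plane → ℝ} {C : ℝ} (hf : ContinuousOn f {0}ᶜ)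
    (h : ∀ x : Plane, x ≠ 0 → ‖x‖ ≤ 1 → |f x| ≤ C / ‖x‖) : Tame f :=
  ⟨hf, isBigO_one_div_norm h⟩

theorem Tame.add {f g : Plane → ℝ} (hf : Tame f) (hg : Tame g) : Tame fun x => f x + g x :=
  ⟨hf.1.add hg.1, hf.2.add hg.2⟩

theorem tame_radial {g : ℝ → ℝ} {C : ℝ} (hg : ContinuousOn g (Set.Ioi 0))
    (h : ∀ r > 0, r ≤ 1 → |g r| ≤ C / r) : Tame fun x => g ‖x‖ :=
  .of_bound (continuousOn_radial hg) fun _ hx h1 => h _ (norm_pos_iff.2 hx) h1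

/-- Each coordinate factor is at most `r` in absolute value, so it allows the profile one more power
of `1 / r`. The two- and three-coordinate versions follow the same count. -/
theorem tame_coord_mul {g : ℝ → ℝ} {C : ℝ} (hg : ContinuousOn g (Set.Ioi 0))
    (h : ∀ r > 0, r ≤ 1 → |g r| ≤ C / r ^ 2) (i : Fin 2) : Tame fun x => x i * g ‖x‖ := by
  refine .of_bound (C := C) ((continuousOn_coord i _).mul (continuousOn_radial hg))
    fun x hx h1 => ?_
  have hr := norm_pos_iff.2 hx
  rw [abs_mul]
  calc _ ≤ ‖x‖ * (C / ‖x‖ ^ 2) :=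
        mul_le_mul (abs_coord_le x i) (h _ hr h1) (abs_nonneg _) hr.le
    _ = C / ‖x‖ := by field_simp

theorem tame_coord_mul_coord_mul {g : ℝ → ℝ} {C : ℝ} (hg : ContinuousOn g (Set.Ioi 0))
    (h : ∀ r > 0, r ≤ 1 → |g r| ≤ C / r ^ 3) (i j : Fin 2) :
    Tame fun x => x i * x j * g ‖x‖ := by
  refine .of_bound (C := C) (((continuousOn_coord i _).mul (continuousOn_coord j _)).mul
    (continuousOn_radial hg)) fun x hx h1 => ?_
  have hr := norm_pos_iff.2 hx
  rw [abs_mul, abs_mul]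
  calc _ ≤ ‖x‖ * ‖x‖ * (C / ‖x‖ ^ 3) :=
        mul_le_mul (mul_le_mul (abs_coord_le x i) (abs_coord_le x j) (abs_nonneg _) hr.le)
          (h _ hr h1) (abs_nonneg _) (by positivity)
    _ = C / ‖x‖ := by field_simp

theorem tame_coord_cube_mul {g : ℝ → ℝ} {C : ℝ} (hg : ContinuousOn g (Set.Ioi 0))
    (h : ∀ r > 0, r ≤ 1 → |g r| ≤ C / r ^ 4) (i j k : Fin 2) :
    Tame fun x => x i * x j * x k * g ‖x‖ := by
  refine .of_bound (C := C) ((((continuousOn_coord i _).mul (continuousOn_coord j _)).mul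
    (continuousOn_coord k _)).mul (continuousOn_radial hg)) fun x hx h1 => ?_
  have hr := norm_pos_iff.2 hx
  rw [abs_mul, abs_mul, abs_mul]
  calc _ ≤ ‖x‖ * ‖x‖ * ‖x‖ * (C / ‖x‖ ^ 4) :=
        mul_le_mul (mul_le_mul (mul_le_mul (abs_coord_le x i) (abs_coord_le x j) (abs_nonneg _)
          hr.le) (abs_coord_le x k) (abs_nonneg _) (by positivity))
          (h _ hr h1) (abs_nonneg _) (by positivity)
    _ = C / ‖x‖ := by field_simp

/-- Writing the radial derivative as `r G(r)` absorbs the factor `1 / r` of the gradient of `r`, so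
that the result is again a coordinate times a radial profile and the rule can be iterated. -/
theorem Represents.pd_radial {g G : ℝ → ℝ} {T : PlaneDist}
    (hT : Represents (fun x => g ‖x‖) T) (hg : ∀ r > 0, HasDerivAt g (r * G r) r)
    (i : Fin 2) (ht : Tame fun x => x i * G ‖x‖) :
    Represents (fun x => x i * G ‖x‖) (RelaxedMicromorphic.pd i T) := by
  refine hT.pd ht.locallyIntegrable fun x hx => ?_
  have hr := norm_pos_iff.2 hx
  refine HasDerivAt.congr_deriv (hasLineDerivAt_radial hx (hg _ hr) i) ?_
  field_simp

theorem Represents.pd_coord_mul_radial {G Q : ℝ → ℝ} {T : PlaneDist} {i : Fin 2}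
    (hT : Represents (fun x => x i * G ‖x‖) T) (hG : ∀ r > 0, HasDerivAt G (r * Q r) r)
    (j : Fin 2) (ht : Tame fun x => G ‖x‖) (ht' : Tame fun x => x i * x j * Q ‖x‖) :
    Represents (fun x => (if i = j then G ‖x‖ else 0) + x i * x j * Q ‖x‖)
      (RelaxedMicromorphic.pd j T) := by
  have h0 : LocallyIntegrable fun x : Plane => if i = j then G ‖x‖ else 0 := by
    split_ifs
    · exact ht.locallyIntegrable
    · exact locallyIntegrable_const 0
  refine hT.pd (h0.add ht'.locallyIntegrable) fun x hx => ?_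
  have hr := norm_pos_iff.2 hx
  have h := hasLineDerivAt_mul (hasLineDerivAt_coord x i j)
    (hasLineDerivAt_radial hx (hG _ hr) j)
  refine HasDerivAt.congr_deriv h ?_
  split_ifs
  · field_simp
  · field_simp
    ring

/-- The derivatives of `x ↦ x₁ x₂ Q(‖x‖)`, where `q` is `Q' / r`. -/
noncomputable def mixedGrad (Q q : ℝ → ℝ) (k : Fin 2) (x : Plane) : ℝ :=
  x (1 - k) * Q ‖x‖ + x 0 * x 1 * x k * q ‖x‖

theorem Represents.pd_mixed {Q q : ℝ → ℝ} {T : PlaneDist}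
    (hT : Represents (fun x => x 0 * x 1 * Q ‖x‖) T) (hQ : ∀ r > 0, HasDerivAt Q (r * q r) r)
    (k : Fin 2) (ht : Tame (mixedGrad Q q k)) :
    Represents (mixedGrad Q q k) (RelaxedMicromorphic.pd k T) := by
  refine hT.pd ht.locallyIntegrable fun x hx => ?_
  have hr := norm_pos_iff.2 hx
  have h := hasLineDerivAt_mul (hasLineDerivAt_mul (hasLineDerivAt_coord x 0 k)
    (hasLineDerivAt_coord x 1 k)) (hasLineDerivAt_radial hx (hQ _ hr) k)
  refine HasDerivAt.congr_deriv h ?_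
  rw [mixedGrad]
  fin_cases k <;> simp <;> field_simp

/-! ### The logarithm, the biharmonic potential and the screened potentials -/

/-- The regular distribution of `log r`. -/
noncomputable def logDist : PlaneDist := regularDist fun x => Real.log ‖x‖

/-- The regular distribution of `r² log r`. -/
noncomputable def biharmonicDist : PlaneDist := regularDist fun x => ‖x‖ ^ 2 * Real.log ‖x‖

/-- The regular distribution of `K₀(r / ℓ) + log r`. -/
noncomputable def screenedDist (l : ℝ) : PlaneDist :=
  regularDist fun x => besselK 0 (‖x‖ / l) + Real.log ‖x‖

theorem continuousOn_log_Ioi : ContinuousOn Real.log (Set.Ioi 0) :=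
  Real.continuousOn_log.mono fun _ hr => ne_of_gt hr

theorem continuousOn_const_div_pow (a : ℝ) (n : ℕ) :
    ContinuousOn (fun r : ℝ => a / r ^ n) (Set.Ioi 0) :=
  continuousOn_const.div (continuousOn_id.pow n) fun _ hr => pow_ne_zero n (ne_of_gt hr)

theorem abs_log_le {r : ℝ} (hr : 0 < r) (h1 : r ≤ 1) : |Real.log r| ≤ 1 / r := by
  rw [abs_of_nonpos (Real.log_nonpos hr.le h1), one_div]
  linarith [Real.one_sub_inv_le_log_of_pos hr]

theorem tame_log : Tame fun x => Real.log ‖x‖ :=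
  tame_radial continuousOn_log_Ioi fun _ hr h1 => abs_log_le hr h1

theorem represents_log : Represents (fun x => Real.log ‖x‖) logDist :=
  .of_locallyIntegrable tame_log.locallyIntegrable

theorem tame_coord_div_sq (i : Fin 2) : Tame fun x => x i * (1 / ‖x‖ ^ 2) :=
  tame_coord_mul (C := 1) (continuousOn_const_div_pow 1 2)
    (fun r _ _ => by rw [abs_of_nonneg (by positivity)]) i

theorem represents_pd_log (i : Fin 2) :
    Represents (fun x => x i * (1 / ‖x‖ ^ 2)) (pd i logDist) := by
  refine represents_log.pd_radial (G := fun r => 1 / r ^ 2) (fun r hr => ?_) i (tame_coord_div_sq i)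
  refine (Real.hasDerivAt_log hr.ne').congr_deriv ?_
  field_simp

theorem laplacian_logDist :
    pd 0 (pd 0 logDist) + pd 1 (pd 1 logDist) =
      (2 * Real.pi) • Distribution.delta (0 : Plane) := by
  refine pd_coord_div_sq (T := fun i => pd i logDist) fun i => ?_
  simpa only [mul_one_div] using represents_pd_log i

theorem represents_pd_pd_biharmonic (i j : Fin 2) :
    Represents (fun x => (if i = j then 2 * Real.log ‖x‖ + 1 else 0)
      + x i * x j * (2 / ‖x‖ ^ 2)) (pd j (pd i biharmonicDist)) := by
  have hc : ContinuousOn (fun r => 2 * Real.log r + 1) (Set.Ioi 0) :=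
    (continuousOn_log_Ioi.const_mul 2).add continuousOn_const
  have hb : ∀ r : ℝ, 0 < r → r ≤ 1 → |2 * Real.log r + 1| ≤ 3 / r := by
    intro r hr h1
    have h2 := abs_le.1 (abs_log_le hr h1)
    have h3 : 1 ≤ 1 / r := (one_le_div hr).2 h1
    rw [abs_le, show 3 / r = 3 * (1 / r) by ring]
    constructor <;> linarith
  have h0 : Tame fun x => ‖x‖ ^ 2 * Real.log ‖x‖ := by
    refine tame_radial (g := fun r => r ^ 2 * Real.log r) (C := 1)
      ((continuousOn_id.pow 2).mul continuousOn_log_Ioi) fun r hr h1 => ?_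
    rw [abs_mul, abs_of_nonneg (sq_nonneg r)]
    have : r ^ 2 ≤ 1 := pow_le_one₀ hr.le h1
    nlinarith [abs_log_le hr h1, abs_nonneg (Real.log r)]
  have h1 : Represents (fun x => x i * (2 * Real.log ‖x‖ + 1)) (pd i biharmonicDist) := by
    refine (Represents.of_locallyIntegrable h0.locallyIntegrable).pd_radial
      (g := fun r => r ^ 2 * Real.log r) (G := fun r => 2 * Real.log r + 1) (fun r hr => ?_) i
      (tame_coord_mul (g := fun r => 2 * Real.log r + 1) (C := 3) hc (fun r hr h1 => ?_) i)
    · refine ((hasDerivAt_pow 2 r).mul (Real.hasDerivAt_log hr.ne')).congr_deriv ?_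
      field_simp
      simp
      ring
    · refine (hb r hr h1).trans ?_
      gcongr
      nlinarith
  refine h1.pd_coord_mul_radial (G := fun r => 2 * Real.log r + 1) (Q := fun r => 2 / r ^ 2)
    (fun r hr => ?_) j (tame_radial (C := 3) hc hb)
    (tame_coord_mul_coord_mul (g := fun r => 2 / r ^ 2) (C := 2)
      (continuousOn_const_div_pow 2 2) (fun r hr h1 => ?_) i j)
  · refine (((Real.hasDerivAt_log hr.ne').const_mul 2).add_const 1).congr_deriv ?_
    field_simp
  · rw [abs_of_nonneg (by positivity)]
    exact div_le_div_of_nonneg_left (by norm_num) (by positivity)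
      (pow_le_pow_of_le_one hr.le h1 (by norm_num))

theorem laplacian_biharmonicDist :
    pd 0 (pd 0 biharmonicDist) + pd 1 (pd 1 biharmonicDist) =
      (4 : ℝ) • logDist + regularDist fun _ => 4 := by
  refine ((represents_pd_pd_biharmonic 0 0).add (represents_pd_pd_biharmonic 1 1)).2.symm.trans
    (Represents.congr ((represents_log.smul 4).add
      (.of_locallyIntegrable (locallyIntegrable_const 4))) fun x hx => ?_).2
  have hr := norm_pos_iff.2 hx
  -- The two rank-one terms sum to `2`, since `x₁² + x₂² = r²`; with `1` from each diagonal term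
  -- this is the constant `4`.
  simp only [if_true]
  field_simp
  linear_combination -2 * norm_sq_eq x

theorem tame_mixedGrad {Q q : ℝ → ℝ} {C : ℝ} (hQ : ContinuousOn Q (Set.Ioi 0))
    (hq : ContinuousOn q (Set.Ioi 0)) (hQb : ∀ r > 0, r ≤ 1 → |Q r| ≤ C / r ^ 2)
    (hqb : ∀ r > 0, r ≤ 1 → |q r| ≤ C / r ^ 4) (k : Fin 2) : Tame (mixedGrad Q q k) :=
  (tame_coord_mul hQ hQb (1 - k)).add (tame_coord_cube_mul hq hqb 0 1 k)

/-- The derivatives of `x₁ x₂ / r²`. -/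
noncomputable def ratioGrad : Fin 2 → Plane → ℝ :=
  mixedGrad (fun r => 1 / r ^ 2) fun r => -2 / r ^ 4

theorem tame_ratioGrad (k : Fin 2) : Tame (ratioGrad k) := by
  refine tame_mixedGrad (C := 2) (continuousOn_const_div_pow 1 2)
    (continuousOn_const_div_pow (-2) 4) (fun r hr _ => ?_) (fun r hr _ => ?_) k
  · rw [abs_of_nonneg (by positivity)]
    gcongr
    norm_num
  · rw [abs_div, abs_of_nonneg (by positivity : 0 ≤ r ^ 4)]
    norm_num

theorem represents_ratio :
    Represents (fun x => x 0 * x 1 * (1 / ‖x‖ ^ 2))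
      ((1 / 2 : ℝ) • pd 1 (pd 0 biharmonicDist)) := by
  refine ((represents_pd_pd_biharmonic 0 1).smul (1 / 2)).congr fun x _ => ?_
  simp
  ring

theorem represents_ratioGrad (k : Fin 2) :
    Represents (ratioGrad k) (pd k ((1 / 2 : ℝ) • pd 1 (pd 0 biharmonicDist))) := by
  refine represents_ratio.pd_mixed (Q := fun r => 1 / r ^ 2) (fun r hr => ?_) k (tame_ratioGrad k)
  refine ((hasDerivAt_const r (1 : ℝ)).div (hasDerivAt_pow 2 r) (by positivity)).congr_deriv ?_
  field_simp
  simp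
  ring

section Screened

variable {l : ℝ}

theorem tame_screened (hl : 0 < l) : Tame fun x => besselK 0 (‖x‖ / l) + Real.log ‖x‖ := by
  refine tame_radial (g := fun r => besselK 0 (r / l) + Real.log r) (C := l + 1)
    (ContinuousOn.add (fun r hr => ?_) continuousOn_log_Ioi) fun r hr h1 => ?_
  · exact (hasDerivAt_besselK_zero_div hl hr).continuousAt.continuousWithinAt
  · refine (abs_add_le _ _).trans ?_
    rw [add_div, abs_of_nonneg (besselK_zero_nonneg _)]
    refine add_le_add ?_ (abs_log_le hr h1)
    simpa using besselK_zero_le (div_pos hr hl)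

theorem tame_Psi_div (hl : 0 < l) : Tame fun x => Psi l ‖x‖ / ‖x‖ := by
  refine tame_radial (g := fun r => Psi l r / r) (C := 1 / l) (continuousOn_Psi hl)
    fun r hr _ => ?_
  obtain ⟨h1, h2⟩ := Psi_bounds hl hr
  rw [abs_of_nonneg (by positivity)]
  gcongr

theorem tame_coord_mul_Psi_div (hl : 0 < l) (i : Fin 2) :
    Tame fun x => x i * (Psi l ‖x‖ / ‖x‖) := by
  refine tame_coord_mul (g := fun r => Psi l r / r) (C := 1 / l) (continuousOn_Psi hl)
    (fun r hr h => ?_) i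
  obtain ⟨h1, h2⟩ := Psi_bounds hl hr
  rw [abs_of_nonneg (by positivity)]
  refine div_le_div₀ (by positivity) h2 (by positivity) ?_
  nlinarith

theorem represents_pd_screened (hl : 0 < l) (i : Fin 2) :
    Represents (fun x => x i * (Psi l ‖x‖ / ‖x‖)) (pd i (screenedDist l)) := by
  refine (Represents.of_locallyIntegrable (tame_screened hl).locallyIntegrable).pd_radial
    (g := fun r => besselK 0 (r / l) + Real.log r) (G := fun r => Psi l r / r)
    (fun r hr => ?_) i (tame_coord_mul_Psi_div hl i)
  refine ((hasDerivAt_besselK_zero_div hl hr).add (Real.hasDerivAt_log hr.ne')).congr_deriv ?_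
  rw [Psi_eq]
  field_simp
  ring

theorem represents_pd_pd_screened (hl : 0 < l) (i j : Fin 2) :
    Represents (fun x => (if i = j then Psi l ‖x‖ / ‖x‖ else 0)
      + x i * x j * (-Phi l ‖x‖ / (l ^ 2 * ‖x‖ ^ 2))) (pd j (pd i (screenedDist l))) := by
  refine (represents_pd_screened hl i).pd_coord_mul_radial (G := fun r => Psi l r / r)
    (Q := fun r => -Phi l r / (l ^ 2 * r ^ 2)) (fun r hr => hasDerivAt_Psi_div hl hr) j
    (tame_Psi_div hl) (tame_coord_mul_coord_mul (g := fun r => -Phi l r / (l ^ 2 * r ^ 2))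
      (C := 1 / l ^ 2) ?_ (fun r hr h => ?_) i j)
  · exact (continuousOn_Phi hl).neg.div (continuousOn_const.mul (continuousOn_id.pow 2))
      fun r hr => by have : 0 < r := hr; positivity
  · obtain ⟨h1, h2⟩ := Phi_bounds hl hr
    rw [neg_div, abs_neg, abs_of_nonneg (by positivity), div_div]
    refine div_le_div₀ zero_le_one (by linarith) (by positivity) ?_
    exact mul_le_mul_of_nonneg_left (pow_le_pow_of_le_one hr.le h (by norm_num)) (by positivity)

/-- The modified Bessel equation: `H - L` is `K₀(r / ℓ)`. No Dirac mass appears, because the added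
logarithm makes first and second derivatives locally integrable. -/
theorem laplacian_screenedDist (hl : 0 < l) :
    pd 0 (pd 0 (screenedDist l)) + pd 1 (pd 1 (screenedDist l)) =
      (1 / l ^ 2) • (screenedDist l - logDist) := by
  refine ((represents_pd_pd_screened hl 0 0).add (represents_pd_pd_screened hl 1 1)).2.symm.trans
    (Represents.congr (((Represents.of_locallyIntegrable
      (tame_screened hl).locallyIntegrable).sub represents_log).smul (1 / l ^ 2)) fun x hx => ?_).2
  have hr := norm_pos_iff.2 hx
  have h := Phi_eq hl hr
  simp only [if_true, add_sub_cancel_right]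
  field_simp at h ⊢
  linear_combination (-‖x‖) * h + Phi l ‖x‖ * norm_sq_eq x

/-- The derivatives of `x₁ x₂ Φ / r²`. -/
noncomputable def screenedRatioGrad (l : ℝ) : Fin 2 → Plane → ℝ :=
  mixedGrad (fun r => Phi l r / r ^ 2) fun r => PhiDeriv l r / r ^ 3 - 2 * Phi l r / r ^ 4

theorem tame_screenedRatioGrad (hl : 0 < l) (k : Fin 2) : Tame (screenedRatioGrad l k) := by
  refine tame_mixedGrad (C := 2) ?_ ?_ (fun r hr _ => ?_) (fun r hr _ => ?_) k
  · exact (continuousOn_Phi hl).div (continuousOn_id.pow 2) fun r hr => pow_ne_zero _ (ne_of_gt hr)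
  · exact ((continuousOn_PhiDeriv hl).div (continuousOn_id.pow 3)
      fun r hr => pow_ne_zero _ (ne_of_gt hr)).sub (((continuousOn_Phi hl).const_mul 2).div
      (continuousOn_id.pow 4) fun r hr => pow_ne_zero _ (ne_of_gt hr))
  · obtain ⟨h1, h2⟩ := Phi_bounds hl hr
    rw [abs_of_nonneg (by positivity)]
    gcongr
    linarith
  · obtain ⟨h1, h2⟩ := Phi_bounds hl hr
    have h3 := abs_PhiDeriv_le hl hr
    refine (abs_sub _ _).trans ?_
    rw [abs_div, abs_of_nonneg (by positivity : 0 ≤ r ^ 3),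
      abs_of_nonneg (by positivity : 0 ≤ 2 * Phi l r / r ^ 4)]
    calc |PhiDeriv l r| / r ^ 3 + 2 * Phi l r / r ^ 4
        ≤ 1 / r / r ^ 3 + 1 / r ^ 4 := by gcongr; linarith
      _ = 2 / r ^ 4 := by field_simp; norm_num

/-- The mixed second derivative has no diagonal term, and the factor `-ℓ²` undoes the `-1 / ℓ²` in
front of `Φ`. -/
theorem represents_screenedRatio (hl : 0 < l) :
    Represents (fun x => x 0 * x 1 * (Phi l ‖x‖ / ‖x‖ ^ 2))
      ((-l ^ 2) • pd 1 (pd 0 (screenedDist l))) := by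
  refine ((represents_pd_pd_screened hl 0 1).smul (-l ^ 2)).congr fun x hx => ?_
  have hr := norm_pos_iff.2 hx
  simp
  field_simp

theorem represents_screenedRatioGrad (hl : 0 < l) (k : Fin 2) :
    Represents (screenedRatioGrad l k) (pd k ((-l ^ 2) • pd 1 (pd 0 (screenedDist l)))) := by
  refine (represents_screenedRatio hl).pd_mixed (Q := fun r => Phi l r / r ^ 2)
    (fun r hr => ?_) k (tame_screenedRatioGrad hl k)
  refine ((hasDerivAt_Phi hl hr).div (hasDerivAt_pow 2 r) (by positivity)).congr_deriv ?_
  field_simp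
  simp
  ring

end Screened

/-! ### The differential system as an algebraic identity -/

set_option maxHeartbeats 4000000 in
/-- The equilibrium equations for potentials `B, L, H, K` in a module with two commuting
endomorphisms, where `Δ B = 4 L + O`, `Δ L = 2 π δ`, `Δ H = (H - L) / ℓ₁²`,
`Δ K = (K - L) / ℓ₂²` and `O` is constant. -/
theorem equilibrium_of_potentials {V : Type*} [AddCommGroup V] [Module ℝ V] {D₀ D₁ : V →ₗ[ℝ] V}
    (comm : ∀ v, D₁ (D₀ v) = D₀ (D₁ v)) {B L O H K δ : V} {pi l₁ l₂ : ℝ}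
    (hO₀ : D₀ O = 0) (hO₁ : D₁ O = 0) (hB : D₀ (D₀ B) + D₁ (D₁ B) = (4 : ℝ) • L + O)
    (hL : D₀ (D₀ L) + D₁ (D₁ L) = (2 * pi) • δ)
    (hH : D₀ (D₀ H) + D₁ (D₁ H) = (1 / l₁) • (H - L))
    (hK : D₀ (D₀ K) + D₁ (D₁ K) = (1 / l₂) • (K - L))
    {me mc mm ke km A D N le lm k₁ k₂ p q a b s : ℝ} (hpi : 0 < pi) (hme : 0 < me)
    (hke : 0 < ke) (hmc : 0 < mc) (hmm : 0 < mm) (hkm : 0 < km) (hA : 0 < A) (hN0 : 0 < N)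
    (hN : N = ke * km * (me + mm) + me * mm * (ke + km)) (hD : D = me * km - ke * mm)
    (hle : le = ke - me) (hlm : lm = km - mm)
    (hl₁ : l₁ = A * ((ke + me) * (km + mm) * me * mm) / (4 * (me + mm) * N))
    (hl₂ : l₂ = A * mm * (me + mc) / (4 * mc * (me + mm)))
    (hk₁ : k₁ = ke * km * (me + mm) ^ 2 / (4 * pi * me * mm * N))
    (hk₂ : k₂ = k₁ + (ke + km) * (me + mm) / (2 * pi * N))
    (hp : p = D ^ 2 / (2 * pi * (ke + me) * (km + mm) * N))
    (hq : q = mc / (2 * pi * me * (mc + me)))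
    (ha : a = ke * km * (me + mm) / (4 * pi * mm * N))
    (hb : b = D * km / (2 * pi * (km + mm) * N)) (hs : s = D / (4 * pi * N))
    {u₀ u₁ P₀₀ P₀₁ P₁₀ P₁₁ E₀₀ E₀₁ E₁₀ E₁₁ S₀₀ S₀₁ S₁₀ S₁₁ v₀ v₁ : V}
    (hu₀ : u₀ = (k₁ / 2) • D₁ (D₀ B) - (p * l₁) • D₁ (D₀ H) + (q * l₂) • D₁ (D₀ K))
    (hu₁ : u₁ = (k₁ / 2) • D₁ (D₁ B) - (k₁ + k₂) • L - (k₁ / 8) • O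
      - (p * l₁) • D₁ (D₁ H) - (q * l₂) • D₀ (D₀ K))
    (hP₀₀ : P₀₀ = (a / 2) • D₀ (D₁ (D₀ B)) - (b * l₁) • D₀ (D₁ (D₀ H)) + s • D₁ H)
    (hP₀₁ : P₀₁ = (a / 2) • D₁ (D₁ (D₀ B)) - (b * l₁) • D₁ (D₁ (D₀ H))
      + (1 / (4 * pi * me)) • D₀ K)
    (hP₁₀ : P₁₀ = (a / 2) • D₁ (D₁ (D₀ B)) - (b * l₁) • D₁ (D₁ (D₀ H))
      - (1 / (4 * pi * me)) • D₀ K - (1 / (2 * pi * mm)) • D₀ L)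
    (hP₁₁ : P₁₁ = -(1 / (2 * pi * (km + mm))) • D₁ L - (a / 2) • D₀ (D₁ (D₀ B))
      + (b * l₁) • D₀ (D₁ (D₀ H)) - (s * (km - mm) / (km + mm)) • D₁ H)
    (hE₀₀ : E₀₀ = D₀ u₀ - P₀₀) (hE₀₁ : E₀₁ = D₁ u₀ - P₀₁) (hE₁₀ : E₁₀ = D₀ u₁ - P₁₀)
    (hE₁₁ : E₁₁ = D₁ u₁ - P₁₁)
    (hS₀₀ : S₀₀ = (2 * me) • E₀₀ + le • (E₀₀ + E₁₁))
    (hS₁₁ : S₁₁ = (2 * me) • E₁₁ + le • (E₀₀ + E₁₁))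
    (hS₀₁ : S₀₁ = me • (E₀₁ + E₁₀) + mc • (E₀₁ - E₁₀))
    (hS₁₀ : S₁₀ = me • (E₀₁ + E₁₀) - mc • (E₀₁ - E₁₀))
    (hv₀ : v₀ = D₀ P₀₁ - D₁ P₀₀) (hv₁ : v₁ = D₀ P₁₁ - D₁ P₁₀) :
    (D₀ S₀₀ + D₁ S₀₁ = 0 ∧ D₀ S₁₀ + D₁ S₁₁ = -δ) ∧
      S₀₀ - ((2 * mm) • P₀₀ + lm • (P₀₀ + P₁₁)) - (me * mm / (me + mm) * A) • D₁ v₀ = 0 ∧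
      S₁₁ - ((2 * mm) • P₁₁ + lm • (P₀₀ + P₁₁)) + (me * mm / (me + mm) * A) • D₀ v₁ = 0 ∧
      S₀₁ - mm • (P₀₁ + P₁₀) + (me * mm / (me + mm) * A) • D₀ v₀ = 0 ∧
      S₁₀ - mm • (P₀₁ + P₁₀) - (me * mm / (me + mm) * A) • D₁ v₁ = 0 := by
  -- The Laplacians are oriented as rules that eliminate a double `D₁`. With `comm` pushing `D₁`
  -- inward, every term gets a normal form: powers of `D₀` applied to `X` or `D₁ X`, with `X` a
  -- potential or `δ`.
  have hB' := eq_sub_of_add_eq' hB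
  have hL' := eq_sub_of_add_eq' hL
  have hH' := eq_sub_of_add_eq' hH
  have hK' := eq_sub_of_add_eq' hK
  clear hB hL hH hK
  subst hv₀ hv₁ hS₀₀ hS₀₁ hS₁₀ hS₁₁ hE₀₀ hE₀₁ hE₁₀ hE₁₁ hP₀₀ hP₀₁ hP₁₀ hP₁₁ hu₀ hu₁
  simp only [map_add, map_sub, map_smul, comm, hB', hL', hH', hK', hO₀, hO₁, map_zero]
  refine ⟨⟨?_, ?_⟩, ?_, ?_, ?_, ?_⟩
  all_goals
    -- `D` and `N` stay opaque while denominators are cleared, `N` being known to be positive, and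
    -- are expanded only for the final polynomial identity.
    match_scalars <;> subst hle hlm hk₂ hp hq hb hl₁ hl₂ hk₁ ha hs <;> field_simp <;>
      subst hD hN <;> ring_nf

namespace Moduli

theorem stress_apply (c : Moduli) (u : Fin 2 → PlaneDist)
    (P : Matrix (Fin 2) (Fin 2) PlaneDist) {E : Fin 2 → Fin 2 → PlaneDist}
    (hE : ∀ i j, E i j = pd j (u i) - P i j) :
    c.stress u P 0 0 = (2 * c.muE) • E 0 0 + c.lamE • (E 0 0 + E 1 1) ∧
    c.stress u P 1 1 = (2 * c.muE) • E 1 1 + c.lamE • (E 0 0 + E 1 1) ∧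
    c.stress u P 0 1 = c.muE • (E 0 1 + E 1 0) + c.muC • (E 0 1 - E 1 0) ∧
    c.stress u P 1 0 = c.muE • (E 0 1 + E 1 0) - c.muC • (E 0 1 - E 1 0) := by
  have h : grad u - P = Matrix.of E := by
    ext1 i j
    rw [Matrix.sub_apply, Matrix.of_apply, hE]
    rfl
  simp only [stress, h, symPart, skewPart, trId, Matrix.add_apply, Matrix.sub_apply,
    Matrix.smul_apply, Matrix.transpose_apply, Matrix.of_apply, Matrix.trace, Matrix.diag_apply,
    Fin.sum_univ_two, Matrix.diagonal_apply_eq]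
  refine ⟨?_, ?_, ?_, ?_⟩
  · module
  · module
  · rw [Matrix.diagonal_apply_ne _ (by decide)]
    module
  · rw [Matrix.diagonal_apply_ne _ (by decide)]
    module

theorem microStress_apply (c : Moduli) (P : Matrix (Fin 2) (Fin 2) PlaneDist) :
    c.microStress P 0 0 = (2 * c.muMicro) • P 0 0 + c.lamMicro • (P 0 0 + P 1 1) ∧
    c.microStress P 1 1 = (2 * c.muMicro) • P 1 1 + c.lamMicro • (P 0 0 + P 1 1) ∧
    c.microStress P 0 1 = c.muMicro • (P 0 1 + P 1 0) ∧
    c.microStress P 1 0 = c.muMicro • (P 0 1 + P 1 0) := by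
  simp only [microStress, symPart, trId, Matrix.add_apply,
    Matrix.smul_apply, Matrix.transpose_apply, Matrix.trace, Matrix.diag_apply,
    Fin.sum_univ_two, Matrix.diagonal_apply_eq]
  refine ⟨?_, ?_, ?_, ?_⟩
  · module
  · module
  · rw [Matrix.diagonal_apply_ne _ (by decide)]
    module
  · rw [Matrix.diagonal_apply_ne _ (by decide)]
    module

/-! ### The coefficients -/

/-- The numerator of `κ_M + μ_M`. -/
noncomputable def macroNum (c : Moduli) : ℝ :=
  c.kappaE * c.kappaMicro * (c.muE + c.muMicro) + c.muE * c.muMicro * (c.kappaE + c.kappaMicro)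

/-- The numerator of `ζ`. -/
noncomputable def zetaNum (c : Moduli) : ℝ := c.muE * c.kappaMicro - c.kappaE * c.muMicro

/-- The coefficient of the non-decaying part of the displacement. -/
noncomputable def coefK (c : Moduli) : ℝ :=
  c.kappaMacro / (4 * Real.pi * c.muMacro * (c.kappaMacro + c.muMacro))

/-- The coefficient of the logarithm in `u₂`. -/
noncomputable def coefLog (c : Moduli) : ℝ :=
  (c.kappaMacro + 2 * c.muMacro) / (4 * Real.pi * c.muMacro * (c.kappaMacro + c.muMacro))

/-- The coefficient of the `ℓ₁` part of the displacement. -/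
noncomputable def coefP (c : Moduli) : ℝ :=
  c.zeta ^ 2 / (2 * Real.pi * c.beta * (c.kappaMacro + c.muMacro))

/-- The coefficient of the `ℓ₂` part of the displacement. -/
noncomputable def coefQ (c : Moduli) : ℝ := c.muC / (2 * Real.pi * c.muE * (c.muC + c.muE))

/-- The coefficient of the macroscopic part of the micro-distortion. -/
noncomputable def coefA (c : Moduli) : ℝ :=
  c.kappaMacro / (4 * Real.pi * c.muMicro * (c.kappaMacro + c.muMacro))

/-- The coefficient of `Φ₁` in the micro-distortion. -/
noncomputable def coefB (c : Moduli) : ℝ :=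
  c.zeta * c.eps / (2 * Real.pi * (c.kappaMicro + c.muMicro) * c.beta)

/-- The coefficient of `Ψ₁` in the micro-distortion. -/
noncomputable def coefS (c : Moduli) : ℝ := c.zeta / (4 * Real.pi * (c.kappaMacro + c.muMacro))

section Coefficients

variable {c : Moduli} (hc : c.PositiveDefinite)
include hc

theorem macroNum_pos : 0 < c.macroNum := by
  obtain ⟨h1, -, h3, h4, h5, -⟩ := hc
  rw [macroNum]
  positivity

/-- Over this common denominator the coefficients and squared lengths become explicit rational
functions of the moduli, as the algebraic system requires. -/
theorem kappaMacro_add_muMacro : c.kappaMacro + c.muMacro =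
    c.macroNum / ((c.kappaE + c.kappaMicro) * (c.muE + c.muMicro)) := by
  obtain ⟨h1, -, h3, h4, h5, -⟩ := hc
  rw [macroNum, kappaMacro, muMacro]
  field_simp

theorem zeta_eq : c.zeta = c.zetaNum / ((c.kappaE + c.kappaMicro) * (c.muE + c.muMicro)) := by
  obtain ⟨h1, -, h3, h4, h5, -⟩ := hc
  rw [zetaNum, zeta, kappaMacro, muMacro]
  field_simp
  ring

theorem coefK_eq : c.coefK = c.kappaE * c.kappaMicro * (c.muE + c.muMicro) ^ 2 /
    (4 * Real.pi * c.muE * c.muMicro * c.macroNum) := by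
  have hN := macroNum_pos hc
  rw [coefK, kappaMacro_add_muMacro hc, kappaMacro, muMacro]
  obtain ⟨h1, -, h3, h4, h5, -⟩ := hc
  field_simp

theorem coefLog_eq : c.coefLog = c.coefK +
    (c.kappaE + c.kappaMicro) * (c.muE + c.muMicro) / (2 * Real.pi * c.macroNum) := by
  have hN := macroNum_pos hc
  rw [coefLog, coefK, kappaMacro_add_muMacro hc, kappaMacro, muMacro]
  obtain ⟨h1, -, h3, h4, h5, -⟩ := hc
  field_simp
  ring

theorem coefP_eq : c.coefP = c.zetaNum ^ 2 /
    (2 * Real.pi * (c.kappaE + c.muE) * (c.kappaMicro + c.muMicro) * c.macroNum) := by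
  have hN := macroNum_pos hc
  rw [coefP, kappaMacro_add_muMacro hc, zeta_eq hc, beta]
  obtain ⟨h1, -, h3, h4, h5, -⟩ := hc
  field_simp

theorem coefA_eq : c.coefA = c.kappaE * c.kappaMicro * (c.muE + c.muMicro) /
    (4 * Real.pi * c.muMicro * c.macroNum) := by
  have hN := macroNum_pos hc
  rw [coefA, kappaMacro_add_muMacro hc, kappaMacro]
  obtain ⟨h1, -, h3, h4, h5, -⟩ := hc
  field_simp

theorem coefB_eq : c.coefB = c.zetaNum * c.kappaMicro /
    (2 * Real.pi * (c.kappaMicro + c.muMicro) * c.macroNum) := by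
  have hN := macroNum_pos hc
  rw [coefB, eps, kappaMacro_add_muMacro hc, zeta_eq hc, beta]
  obtain ⟨h1, -, h3, h4, h5, -⟩ := hc
  field_simp

theorem coefS_eq : c.coefS = c.zetaNum / (4 * Real.pi * c.macroNum) := by
  have hN := macroNum_pos hc
  rw [coefS, kappaMacro_add_muMacro hc, zeta_eq hc]
  obtain ⟨h1, -, h3, h4, h5, -⟩ := hc
  field_simp

theorem aTilde_pos (hLc : 0 < c.Lc) : 0 < c.aTilde :=
  pos_of_mul_pos_left hc.curvature_pos (by positivity)

theorem ell1_radicand_eq :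
    c.aTilde * c.beta * c.muMacro / (4 * (c.kappaMacro + c.muMacro)) =
      c.aTilde * ((c.kappaE + c.muE) * (c.kappaMicro + c.muMicro) * c.muE * c.muMicro) /
        (4 * (c.muE + c.muMicro) * c.macroNum) := by
  have hN := macroNum_pos hc
  rw [kappaMacro_add_muMacro hc, beta, muMacro]
  obtain ⟨h1, -, h3, h4, h5, -⟩ := hc
  field_simp

theorem ell2_radicand_eq (hmuC : 0 < c.muC) :
    c.aTilde * c.muMacro * (c.muE + c.muC) / (4 * c.muC * c.muE) =
      c.aTilde * c.muMicro * (c.muE + c.muC) / (4 * c.muC * (c.muE + c.muMicro)) := by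
  rw [muMacro]
  obtain ⟨h1, -, h3, h4, h5, -⟩ := hc
  field_simp

theorem ell1_radicand_pos (hLc : 0 < c.Lc) :
    0 < c.aTilde * c.beta * c.muMacro / (4 * (c.kappaMacro + c.muMacro)) := by
  have hN := macroNum_pos hc
  have ha := aTilde_pos hc hLc
  rw [ell1_radicand_eq hc]
  obtain ⟨h1, -, h3, h4, h5, -⟩ := hc
  positivity

theorem ell2_radicand_pos (hmuC : 0 < c.muC) (hLc : 0 < c.Lc) :
    0 < c.aTilde * c.muMacro * (c.muE + c.muC) / (4 * c.muC * c.muE) := by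
  have ha := aTilde_pos hc hLc
  rw [ell2_radicand_eq hc hmuC]
  obtain ⟨h1, -, h3, h4, h5, -⟩ := hc
  positivity

theorem ell1_pos (hLc : 0 < c.Lc) : 0 < c.ell1 :=
  mul_pos hLc (Real.sqrt_pos.2 (ell1_radicand_pos hc hLc))

theorem ell2_pos (hmuC : 0 < c.muC) (hLc : 0 < c.Lc) : 0 < c.ell2 :=
  mul_pos hLc (Real.sqrt_pos.2 (ell2_radicand_pos hc hmuC hLc))

theorem ell1_sq (hLc : 0 < c.Lc) : c.ell1 ^ 2 = c.Lc ^ 2 * c.aTilde *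
    ((c.kappaE + c.muE) * (c.kappaMicro + c.muMicro) * c.muE * c.muMicro) /
      (4 * (c.muE + c.muMicro) * c.macroNum) := by
  rw [ell1, mul_pow, Real.sq_sqrt (ell1_radicand_pos hc hLc).le, ell1_radicand_eq hc]
  ring

theorem ell2_sq (hmuC : 0 < c.muC) (hLc : 0 < c.Lc) : c.ell2 ^ 2 = c.Lc ^ 2 * c.aTilde *
    c.muMicro * (c.muE + c.muC) / (4 * c.muC * (c.muE + c.muMicro)) := by
  rw [ell2, mul_pow, Real.sq_sqrt (ell2_radicand_pos hc hmuC hLc).le, ell2_radicand_eq hc hmuC]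
  ring

/-- The logarithmic singularity of `u₂` is not cancelled by the Bessel functions. -/
theorem coefLog_sub_pos (hmuC : 0 < c.muC) : 0 < c.coefLog - c.coefP / 2 - c.coefQ / 2 := by
  have hN := macroNum_pos hc
  have hπ := Real.pi_pos
  rw [coefLog_eq hc, coefP_eq hc, coefQ, coefK_eq hc]
  obtain ⟨h1, -, h3, h4, h5, -⟩ := hc
  -- Both squares of `zetaNum ^ 2` occur in the expanded product, so the difference has only
  -- positive coefficients.
  have hDN : c.zetaNum ^ 2 < (c.kappaE + c.muE) * (c.kappaMicro + c.muMicro) *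
      ((c.kappaE + c.kappaMicro) * (c.muE + c.muMicro)) := by
    rw [← sub_pos, zetaNum]
    ring_nf
    positivity
  have hP : c.zetaNum ^ 2 /
      (2 * Real.pi * (c.kappaE + c.muE) * (c.kappaMicro + c.muMicro) * c.macroNum) / 2 <
      (c.kappaE + c.kappaMicro) * (c.muE + c.muMicro) / (4 * Real.pi * c.macroNum) := by
    rw [div_div, div_lt_div_iff₀ (by positivity) (by positivity)]
    have := mul_lt_mul_of_pos_right hDN (show 0 < 4 * Real.pi * c.macroNum by positivity)
    linarith
  have hQ : c.muC / (2 * Real.pi * c.muE * (c.muC + c.muE)) / 2 < 1 / (4 * Real.pi * c.muE) := by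
    rw [div_div, div_lt_div_iff₀ (by positivity) (by positivity)]
    have : 0 < 4 * Real.pi * c.muE * c.muE := by positivity
    linarith
  -- Half of the second summand of `coefLog` pays for the `ℓ₁` loss. The other half and `coefK` add
  -- up exactly to this sum, whose first term pays for the `ℓ₂` loss and whose second survives as a
  -- lower bound.
  have hK : c.kappaE * c.kappaMicro * (c.muE + c.muMicro) ^ 2 /
      (4 * Real.pi * c.muE * c.muMicro * c.macroNum) +
      (c.kappaE + c.kappaMicro) * (c.muE + c.muMicro) / (4 * Real.pi * c.macroNum) =
      1 / (4 * Real.pi * c.muE) + 1 / (4 * Real.pi * c.muMicro) := by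
    field_simp
    rw [macroNum]
    ring
  have hm : 0 < 1 / (4 * Real.pi * c.muMicro) := by positivity
  have h2 : (c.kappaE + c.kappaMicro) * (c.muE + c.muMicro) / (2 * Real.pi * c.macroNum) =
      2 * ((c.kappaE + c.kappaMicro) * (c.muE + c.muMicro) / (4 * Real.pi * c.macroNum)) := by
    field_simp
    norm_num
  linarith

end Coefficients

end Moduli

/-! ### Further stability of `Tame`, and closed forms of the gradients. -/

theorem Tame.congr {f g : Plane → ℝ} (hf : Tame f) (h : ∀ x ≠ 0, g x = f x) : Tame g :=
  ⟨hf.1.congr fun x hx => h x hx, hf.2.congr' (by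
    filter_upwards [self_mem_nhdsWithin] with x hx using (h x hx).symm) .rfl⟩

theorem Tame.const_mul {f : Plane → ℝ} (hf : Tame f) (a : ℝ) : Tame fun x => a * f x :=
  ⟨continuousOn_const.mul hf.1, hf.2.const_mul_left a⟩

theorem Tame.sub {f g : Plane → ℝ} (hf : Tame f) (hg : Tame g) : Tame fun x => f x - g x :=
  ⟨hf.1.sub hg.1, hf.2.sub hg.2⟩

theorem ratioGrad_zero {x : Plane} (hx : x ≠ 0) :
    ratioGrad 0 x = -(x 1 * (x 0 ^ 2 - x 1 ^ 2) / ‖x‖ ^ 4) := by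
  have hr := norm_pos_iff.2 hx
  simp only [ratioGrad, mixedGrad, sub_zero]
  field_simp
  linear_combination x 1 * norm_sq_eq x

theorem ratioGrad_one {x : Plane} (hx : x ≠ 0) :
    ratioGrad 1 x = x 0 * (x 0 ^ 2 - x 1 ^ 2) / ‖x‖ ^ 4 := by
  have hr := norm_pos_iff.2 hx
  simp only [ratioGrad, mixedGrad, sub_self]
  field_simp
  linear_combination x 0 * norm_sq_eq x

theorem screenedRatioGrad_zero {l : ℝ} (hl : 0 < l) {x : Plane} (hx : x ≠ 0) :
    screenedRatioGrad l 0 x = -(x 1 * (x 0 ^ 2 - x 1 ^ 2) / ‖x‖ ^ 4 * Phi l ‖x‖)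
      + x 0 * x 1 / ‖x‖ ^ 2 * dPhi l 0 x := by
  have hr := norm_pos_iff.2 hx
  simp only [screenedRatioGrad, mixedGrad, sub_zero, dPhi_eq hl hx]
  field_simp
  linear_combination x 1 * Phi l ‖x‖ * norm_sq_eq x

theorem screenedRatioGrad_one {l : ℝ} (hl : 0 < l) {x : Plane} (hx : x ≠ 0) :
    screenedRatioGrad l 1 x = x 0 * (x 0 ^ 2 - x 1 ^ 2) / ‖x‖ ^ 4 * Phi l ‖x‖
      + x 0 * x 1 / ‖x‖ ^ 2 * dPhi l 1 x := by
  have hr := norm_pos_iff.2 hx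
  simp only [screenedRatioGrad, mixedGrad, sub_self, dPhi_eq hl hx]
  field_simp
  linear_combination x 0 * Phi l ‖x‖ * norm_sq_eq x

namespace Moduli

variable {c : Moduli}

/-! ### The fields in terms of derivatives of potentials -/

theorem greenU1_eq (c : Moduli) (x : Plane) :
    c.greenU1 x = c.coefK * (x 0 * x 1 * (1 / ‖x‖ ^ 2))
      + c.coefP * (x 0 * x 1 * (Phi c.ell1 ‖x‖ / ‖x‖ ^ 2))
      - c.coefQ * (x 0 * x 1 * (Phi c.ell2 ‖x‖ / ‖x‖ ^ 2)) := by
  rw [greenU1, coefK, coefP, coefQ]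
  -- With the sums as atoms the denominators are monomials, whose inverses `ring` can split.
  generalize c.kappaMacro + c.muMacro = w
  generalize c.muC + c.muE = v
  ring

theorem greenU2_eq (c : Moduli) (x : Plane) :
    c.greenU2 x = c.coefK * (x 1 * x 1 * (1 / ‖x‖ ^ 2)) - c.coefLog * Real.log ‖x‖
      - c.coefP / 2 * ((x 0 ^ 2 - x 1 ^ 2) / ‖x‖ ^ 2 * Phi c.ell1 ‖x‖
        + besselK 0 (‖x‖ / c.ell1))
      + c.coefQ / 2 * ((x 0 ^ 2 - x 1 ^ 2) / ‖x‖ ^ 2 * Phi c.ell2 ‖x‖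
        - besselK 0 (‖x‖ / c.ell2)) := by
  rw [greenU2, coefK, coefP, coefQ, coefLog]
  generalize c.kappaMacro + c.muMacro = w
  generalize c.muC + c.muE = v
  ring

theorem greenP11_eq (h1 : 0 < c.ell1) {x : Plane} (hx : x ≠ 0) :
    c.greenP11 x = c.coefA * ratioGrad 0 x + c.coefB * screenedRatioGrad c.ell1 0 x
      + c.coefS * (x 1 * (Psi c.ell1 ‖x‖ / ‖x‖)) := by
  rw [ratioGrad_zero hx, screenedRatioGrad_zero h1 hx, greenP11, coefA, coefB, coefS]
  generalize c.kappaMacro + c.muMacro = w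
  generalize c.kappaMicro + c.muMicro = v
  ring

theorem greenP12_eq (h1 : 0 < c.ell1) {x : Plane} (hx : x ≠ 0) :
    c.greenP12 x = c.coefA * ratioGrad 1 x + c.coefB * screenedRatioGrad c.ell1 1 x
      + 1 / (4 * Real.pi * c.muE) * (x 0 * (Psi c.ell2 ‖x‖ / ‖x‖)) := by
  rw [ratioGrad_one hx, screenedRatioGrad_one h1 hx, greenP12, coefA, coefB]
  generalize c.kappaMacro + c.muMacro = w
  generalize c.kappaMicro + c.muMicro = v
  ring

theorem greenP21_eq (h1 : 0 < c.ell1) {x : Plane} (hx : x ≠ 0) :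
    c.greenP21 x = c.coefA * ratioGrad 1 x + c.coefB * screenedRatioGrad c.ell1 1 x
      - 1 / (4 * Real.pi * c.muE) * (x 0 * (Psi c.ell2 ‖x‖ / ‖x‖))
      - 1 / (2 * Real.pi * c.muMicro) * (x 0 * (1 / ‖x‖ ^ 2)) := by
  rw [ratioGrad_one hx, screenedRatioGrad_one h1 hx, greenP21, coefA, coefB]
  generalize c.kappaMacro + c.muMacro = w
  generalize c.kappaMicro + c.muMicro = v
  ring

theorem greenP22_eq (h1 : 0 < c.ell1) {x : Plane} (hx : x ≠ 0) :
    c.greenP22 x = -(1 / (2 * Real.pi * (c.kappaMicro + c.muMicro))) * (x 1 * (1 / ‖x‖ ^ 2))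
      - c.coefA * ratioGrad 0 x - c.coefB * screenedRatioGrad c.ell1 0 x
      - c.coefS * (c.kappaMicro - c.muMicro) / (c.kappaMicro + c.muMicro)
        * (x 1 * (Psi c.ell1 ‖x‖ / ‖x‖)) := by
  rw [ratioGrad_zero hx, screenedRatioGrad_zero h1 hx, greenP22, coefA, coefB, coefS]
  generalize c.kappaMacro + c.muMacro = w
  generalize c.kappaMicro + c.muMicro = v
  ring

/-- The displacement as a distribution. -/
noncomputable def distU (c : Moduli) : Fin 2 → PlaneDist :=
  ![(c.coefK / 2) • pd 1 (pd 0 biharmonicDist)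
      - (c.coefP * c.ell1 ^ 2) • pd 1 (pd 0 (screenedDist c.ell1))
      + (c.coefQ * c.ell2 ^ 2) • pd 1 (pd 0 (screenedDist c.ell2)),
    (c.coefK / 2) • pd 1 (pd 1 biharmonicDist) - (c.coefK + c.coefLog) • logDist
      - (c.coefK / 8) • regularDist (fun _ => 4)
      - (c.coefP * c.ell1 ^ 2) • pd 1 (pd 1 (screenedDist c.ell1))
      - (c.coefQ * c.ell2 ^ 2) • pd 0 (pd 0 (screenedDist c.ell2))]

/-- The micro-distortion as a distribution. -/
noncomputable def distP (c : Moduli) : Matrix (Fin 2) (Fin 2) PlaneDist :=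
  !![(c.coefA / 2) • pd 0 (pd 1 (pd 0 biharmonicDist))
      - (c.coefB * c.ell1 ^ 2) • pd 0 (pd 1 (pd 0 (screenedDist c.ell1)))
      + c.coefS • pd 1 (screenedDist c.ell1),
    (c.coefA / 2) • pd 1 (pd 1 (pd 0 biharmonicDist))
      - (c.coefB * c.ell1 ^ 2) • pd 1 (pd 1 (pd 0 (screenedDist c.ell1)))
      + (1 / (4 * Real.pi * c.muE)) • pd 0 (screenedDist c.ell2);
    (c.coefA / 2) • pd 1 (pd 1 (pd 0 biharmonicDist))
      - (c.coefB * c.ell1 ^ 2) • pd 1 (pd 1 (pd 0 (screenedDist c.ell1)))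
      - (1 / (4 * Real.pi * c.muE)) • pd 0 (screenedDist c.ell2)
      - (1 / (2 * Real.pi * c.muMicro)) • pd 0 logDist,
    -(1 / (2 * Real.pi * (c.kappaMicro + c.muMicro))) • pd 1 logDist
      - (c.coefA / 2) • pd 0 (pd 1 (pd 0 biharmonicDist))
      + (c.coefB * c.ell1 ^ 2) • pd 0 (pd 1 (pd 0 (screenedDist c.ell1)))
      - (c.coefS * (c.kappaMicro - c.muMicro) / (c.kappaMicro + c.muMicro))
        • pd 1 (screenedDist c.ell1)]

theorem pd_smul (i : Fin 2) (a : ℝ) (T : PlaneDist) : pd i (a • T) = a • pd i T :=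
  (pdLin i).map_smul a T

theorem represents_greenU (h1 : 0 < c.ell1) (h2 : 0 < c.ell2) (i : Fin 2) :
    Represents (c.greenU i) (c.distU i) := by
  fin_cases i
  · have h := ((represents_ratio.smul c.coefK).add
      ((represents_screenedRatio h1).smul c.coefP)).sub
        ((represents_screenedRatio h2).smul c.coefQ)
    refine ⟨(h.congr fun x _ => c.greenU1_eq x).1, ((h.congr fun x _ => c.greenU1_eq x).2).trans ?_⟩
    simp only [distU, Fin.zero_eta, Matrix.cons_val_zero]
    module
  -- The second derivative of `r² log r` brings along `2 log r + 1`: the logarithm is removed by the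
  -- extra `coefK` in front of `log`, the constant `coefK / 2` by `coefK / 8` times `4`.
  · have h := ((((represents_pd_pd_biharmonic 1 1).smul (c.coefK / 2)).sub
      (represents_log.smul (c.coefK + c.coefLog))).sub
      ((Represents.of_locallyIntegrable (locallyIntegrable_const 4)).smul (c.coefK / 8))).sub
      ((represents_pd_pd_screened h1 1 1).smul (c.coefP * c.ell1 ^ 2)) |>.sub
      ((represents_pd_pd_screened h2 0 0).smul (c.coefQ * c.ell2 ^ 2))
    refine h.congr fun x hx => ?_
    have hr := norm_pos_iff.2 hx
    have e1 := Phi_eq h1 hr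
    have e2 := Phi_eq h2 hr
    change c.greenU2 x = _
    rw [greenU2_eq]
    simp only [if_true]
    rw [show besselK 0 (‖x‖ / c.ell1) = 2 * c.ell1 ^ 2 / ‖x‖ * Psi c.ell1 ‖x‖ - Phi c.ell1 ‖x‖ by
        linarith, show besselK 0 (‖x‖ / c.ell2) = 2 * c.ell2 ^ 2 / ‖x‖ * Psi c.ell2 ‖x‖
        - Phi c.ell2 ‖x‖ by linarith]
    field_simp
    linear_combination 8 * (c.coefP * Phi c.ell1 ‖x‖ + c.coefQ * Phi c.ell2 ‖x‖) * norm_sq_eq x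

theorem represents_greenP (h1 : 0 < c.ell1) (h2 : 0 < c.ell2) (i j : Fin 2) :
    Represents (c.greenP i j) (c.distP i j) := by
  have hA := fun k => (represents_ratioGrad k).smul c.coefA
  have hB := fun k => (represents_screenedRatioGrad h1 k).smul c.coefB
  fin_cases i <;> fin_cases j
  · have h := (((hA 0).add (hB 0)).add ((represents_pd_screened h1 1).smul c.coefS)).congr
      fun x hx => greenP11_eq h1 hx
    refine ⟨h.1, h.2.trans ?_⟩
    simp only [distP, pd_smul, Fin.zero_eta, Matrix.of_apply, Matrix.cons_val_zero]
    module
  · have h := (((hA 1).add (hB 1)).add ((represents_pd_screened h2 0).smul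
      (1 / (4 * Real.pi * c.muE)))).congr fun x hx => greenP12_eq h1 hx
    refine ⟨h.1, h.2.trans ?_⟩
    simp only [distP, pd_smul, Fin.zero_eta, Fin.mk_one, Matrix.of_apply, Matrix.cons_val_zero,
      Matrix.cons_val_one]
    module
  · have h := ((((hA 1).add (hB 1)).sub ((represents_pd_screened h2 0).smul
      (1 / (4 * Real.pi * c.muE)))).sub ((represents_pd_log 0).smul
      (1 / (2 * Real.pi * c.muMicro)))).congr fun x hx => greenP21_eq h1 hx
    refine ⟨h.1, h.2.trans ?_⟩
    simp only [distP, pd_smul, Fin.zero_eta, Fin.mk_one, Matrix.of_apply, Matrix.cons_val_zero,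
      Matrix.cons_val_one]
    module
  · have h := (((((represents_pd_log 1).smul
      (-(1 / (2 * Real.pi * (c.kappaMicro + c.muMicro))))).sub (hA 0)).sub (hB 0)).sub
      ((represents_pd_screened h1 1).smul (c.coefS * (c.kappaMicro - c.muMicro) /
      (c.kappaMicro + c.muMicro)))).congr fun x hx => greenP22_eq h1 hx
    refine ⟨h.1, h.2.trans ?_⟩
    simp only [distP, pd_smul, Fin.mk_one, Matrix.of_apply, Matrix.cons_val_one,
      Matrix.cons_val_fin_one]
    module

theorem tame_greenP (h1 : 0 < c.ell1) (h2 : 0 < c.ell2) (i j : Fin 2) :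
    Tame (c.greenP i j) := by
  have hA := fun k => (tame_ratioGrad k).const_mul c.coefA
  have hB := fun k => (tame_screenedRatioGrad h1 k).const_mul c.coefB
  have hS1 := tame_coord_mul_Psi_div h1 1
  have hS2 := tame_coord_mul_Psi_div h2 0
  fin_cases i <;> fin_cases j
  · exact (((hA 0).add (hB 0)).add (hS1.const_mul _)).congr fun x hx => greenP11_eq h1 hx
  · exact (((hA 1).add (hB 1)).add (hS2.const_mul _)).congr fun x hx => greenP12_eq h1 hx
  · exact ((((hA 1).add (hB 1)).sub (hS2.const_mul _)).sub
      ((tame_coord_div_sq 0).const_mul _)).congr fun x hx => greenP21_eq h1 hx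
  · exact (((((tame_coord_div_sq 1).const_mul _).sub (hA 0)).sub (hB 0)).sub
      (hS1.const_mul _)).congr fun x hx => greenP22_eq h1 hx

/-- The algebraic system is applied with `A = L_c² ã`; its `l₁` and `l₂` are the squares of the
characteristic lengths, and its `O` is the constant `4`. -/
theorem equilibrium_dist (hc : c.PositiveDefinite) (hmuC : 0 < c.muC) (hLc : 0 < c.Lc) :
    c.Equilibrium c.distU c.distP ![0, -Distribution.delta (0 : Plane)] 0 := by
  have h1 := ell1_pos hc hLc
  have h2 := ell2_pos hc hmuC hLc
  obtain ⟨⟨g1, g2⟩, g3, g4, g5, g6⟩ := equilibrium_of_potentials (D₀ := pdLin 0) (D₁ := pdLin 1)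
    (fun v => pd_comm 1 0 v) (pd_regularDist_const 0 4) (pd_regularDist_const 1 4)
    laplacian_biharmonicDist laplacian_logDist (laplacian_screenedDist h1)
    (laplacian_screenedDist h2) (A := c.Lc ^ 2 * c.aTilde) (le := c.lamE) (lm := c.lamMicro)
    Real.pi_pos hc.muE_pos hc.kappaE_pos hmuC hc.muMicro_pos hc.kappaMicro_pos
    (mul_pos (pow_pos hLc 2) (aTilde_pos hc hLc)) (macroNum_pos hc) rfl rfl
    (by rw [kappaE]; ring) (by rw [kappaMicro]; ring) (ell1_sq hc hLc) (ell2_sq hc hmuC hLc)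
    (coefK_eq hc) (coefLog_eq hc) (coefP_eq hc) rfl (coefA_eq hc) (coefB_eq hc) (coefS_eq hc)
    (u₀ := c.distU 0) (u₁ := c.distU 1) (P₀₀ := c.distP 0 0) (P₀₁ := c.distP 0 1)
    (P₁₀ := c.distP 1 0) (P₁₁ := c.distP 1 1) rfl rfl rfl rfl rfl rfl rfl rfl rfl rfl
    rfl rfl rfl rfl rfl rfl
  obtain ⟨s1, s2, s3, s4⟩ := c.stress_apply c.distU c.distP
    (E := fun i j => pd j (c.distU i) - c.distP i j) fun _ _ => rfl
  obtain ⟨m1, m2, m3, m4⟩ := c.microStress_apply c.distP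
  have hcoef : c.muMacro * c.Lc ^ 2 * c.aTilde =
      c.muE * c.muMicro / (c.muE + c.muMicro) * (c.Lc ^ 2 * c.aTilde) := by
    rw [muMacro]; ring
  refine ⟨?_, ?_⟩
  · ext1 i
    fin_cases i
    · simp only [rowDiv, Fin.sum_univ_two, Fin.zero_eta, s1, s3]
      exact g1
    · simp only [rowDiv, Fin.sum_univ_two, Fin.mk_one, s2, s4]
      exact g2
  · rw [hcoef]
    ext1 i j
    fin_cases i <;> fin_cases j
    · simp only [Matrix.sub_apply, Matrix.smul_apply, Fin.zero_eta, s1, m1]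
      exact g3
    · simp only [Matrix.sub_apply, Matrix.smul_apply, Fin.zero_eta, Fin.mk_one, s3, m3]
      refine Eq.trans ?_ g5
      simp only [curlCurl2D, curl2D, Matrix.of_apply, Matrix.cons_val_one,
        Matrix.cons_val_fin_one, smul_neg, sub_neg_eq_add]
      rfl
    · simp only [Matrix.sub_apply, Matrix.smul_apply, Fin.zero_eta, Fin.mk_one, s4, m4]
      exact g6
    · simp only [Matrix.sub_apply, Matrix.smul_apply, Fin.mk_one, s2, m2]
      refine Eq.trans ?_ g4
      simp only [curlCurl2D, curl2D, Matrix.of_apply, Matrix.cons_val_one,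
        Matrix.cons_val_fin_one, smul_neg, sub_neg_eq_add]
      rfl

end Moduli

/-! ### Behaviour at the origin -/

theorem isBigO_one_of_bound {f : Plane → ℝ} {C : ℝ} (h : ∀ x : Plane, x ≠ 0 → |f x| ≤ C) :
    f =O[𝓝[≠] 0] fun _ => (1 : ℝ) := by
  refine IsBigO.of_bound C ?_
  filter_upwards [self_mem_nhdsWithin] with x hx
  simpa using h x hx

theorem isBigO_coord_mul_coord {g : ℝ → ℝ} {C : ℝ} (h : ∀ r > 0, |g r| ≤ C)
    (i j : Fin 2) :
    (fun x : Plane => x i * x j * (g ‖x‖ / ‖x‖ ^ 2)) =O[𝓝[≠] 0] fun _ => (1 : ℝ) := by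
  refine isBigO_one_of_bound (C := C) fun x hx => ?_
  have hr := norm_pos_iff.2 hx
  rw [abs_mul, abs_mul, abs_div, abs_of_nonneg (sq_nonneg ‖x‖), ← mul_div_assoc,
    div_le_iff₀ (by positivity), sq, mul_comm C]
  exact mul_le_mul (mul_le_mul (abs_coord_le x i) (abs_coord_le x j) (abs_nonneg _) hr.le)
    (h _ hr) (abs_nonneg _) (by positivity)

theorem isBigO_coord_mul_coord_mul_Phi {l : ℝ} (hl : 0 < l) (i j : Fin 2) :
    (fun x : Plane => x i * x j * (Phi l ‖x‖ / ‖x‖ ^ 2)) =O[𝓝[≠] 0] fun _ => (1 : ℝ) :=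
  isBigO_coord_mul_coord (C := 1 / 2) (fun r hr => by
    obtain ⟨h1, h2⟩ := Phi_bounds hl hr
    rwa [abs_of_nonneg h1]) i j

theorem isBigO_coord_mul_coord_div (i j : Fin 2) :
    (fun x : Plane => x i * x j * (1 / ‖x‖ ^ 2)) =O[𝓝[≠] 0] fun _ => (1 : ℝ) :=
  isBigO_coord_mul_coord (g := fun _ => 1) (C := 1) (fun _ _ => by simp) i j

theorem isBigO_screened {l : ℝ} (hl : 0 < l) :
    (fun x : Plane => besselK 0 (‖x‖ / l) + Real.log ‖x‖) =O[𝓝[≠] 0] fun _ => (1 : ℝ) := by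
  refine IsBigO.of_bound (|besselK 0 1| + 1 + |Real.log l|) ?_
  filter_upwards [self_mem_nhdsWithin, mem_nhdsWithin_of_mem_nhds
    (Metric.closedBall_mem_nhds (0 : Plane) hl)] with x hx h1
  have hr : 0 < ‖x‖ := norm_pos_iff.2 hx
  have h2 := besselK_zero_add_log_bounds (div_pos hr hl)
    ((div_le_one hl).2 (by simpa using h1))
  rw [Real.log_div hr.ne' hl.ne'] at h2
  rw [Real.norm_eq_abs, norm_one, mul_one]
  calc |besselK 0 (‖x‖ / l) + Real.log ‖x‖|
      = |(besselK 0 (‖x‖ / l) + (Real.log ‖x‖ - Real.log l)) + Real.log l| := by ring_nf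
    _ ≤ _ := (abs_add_le _ _).trans (by gcongr)

namespace Moduli

variable {c : Moduli}

theorem isBigO_greenU1 (h1 : 0 < c.ell1) (h2 : 0 < c.ell2) :
    c.greenU1 =O[𝓝[≠] (0 : Plane)] fun _ => (1 : ℝ) := by
  rw [funext c.greenU1_eq]
  exact (((isBigO_coord_mul_coord_div 0 1).const_mul_left _).add
    ((isBigO_coord_mul_coord_mul_Phi h1 0 1).const_mul_left _)).sub
    ((isBigO_coord_mul_coord_mul_Phi h2 0 1).const_mul_left _)

/-- Each `K₀(r / ℓ)` is a bounded function minus `log r`, so the two Bessel terms lower the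
coefficient of `-log r` by `coefP / 2` and `coefQ / 2`; everything else is bounded. -/
theorem isBigO_greenU2 (h1 : 0 < c.ell1) (h2 : 0 < c.ell2) :
    (fun x => c.greenU2 x + (c.coefLog - c.coefP / 2 - c.coefQ / 2) * Real.log ‖x‖)
      =O[𝓝[≠] (0 : Plane)] fun _ => (1 : ℝ) := by
  have h := (((((isBigO_coord_mul_coord_div 1 1).const_mul_left c.coefK).sub
    (((isBigO_coord_mul_coord_mul_Phi h1 0 0).sub
      (isBigO_coord_mul_coord_mul_Phi h1 1 1)).const_mul_left (c.coefP / 2))).sub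
    ((isBigO_screened h1).const_mul_left (c.coefP / 2))).add
    (((isBigO_coord_mul_coord_mul_Phi h2 0 0).sub
      (isBigO_coord_mul_coord_mul_Phi h2 1 1)).const_mul_left (c.coefQ / 2))).sub
    ((isBigO_screened h2).const_mul_left (c.coefQ / 2))
  refine h.congr_left fun x => ?_
  rw [greenU2_eq]
  ring

/-- The Frobenius norm of the micro-distortion. -/
noncomputable def normP (c : Moduli) (x : Plane) : ℝ := √(∑ i, ∑ j, c.greenP i j x ^ 2)

theorem abs_greenP_le_normP (c : Moduli) (x : Plane) (i j : Fin 2) :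
    |c.greenP i j x| ≤ c.normP x := by
  refine Real.abs_le_sqrt ?_
  refine le_trans ?_ (Finset.single_le_sum
    (f := fun i => ∑ j, c.greenP i j x ^ 2) (fun i _ => by positivity) (Finset.mem_univ i))
  exact Finset.single_le_sum (f := fun j => c.greenP i j x ^ 2) (fun j _ => by positivity)
    (Finset.mem_univ j)

theorem abs_coord_mul_Psi_le {l : ℝ} (hl : 0 < l) {x : Plane} (hx : x ≠ 0) (i : Fin 2) :
    |x i * (Psi l ‖x‖ / ‖x‖)| ≤ 1 / l := by
  have hr := norm_pos_iff.2 hx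
  obtain ⟨h1, h2⟩ := Psi_bounds hl hr
  rw [abs_mul, abs_of_nonneg (by positivity : 0 ≤ Psi l ‖x‖ / ‖x‖), ← mul_div_assoc,
    div_le_iff₀ hr, mul_comm]
  exact mul_le_mul h2 (abs_coord_le x i) (abs_nonneg _) (by positivity)

/-- The gradient terms with coefficients `coefA` and `coefB` cancel in both `P₁₂ - P₂₁` and `P₁₁ +
P₂₂`. What remains is `m x₁ / r²` and `-n x₂ / r²` up to bounded `Ψ` terms, and `1 / r` is at most
`(|x₁| + |x₂|) / r²`. -/
theorem exists_one_div_norm_le (hc : c.PositiveDefinite) (h1 : 0 < c.ell1) (h2 : 0 < c.ell2) :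
    ∃ A B : ℝ, 0 < A ∧ ∀ x : Plane, x ≠ 0 → 1 / ‖x‖ ≤ A * c.normP x + B := by
  set t := 1 / (4 * Real.pi * c.muE) with ht
  set m := 1 / (2 * Real.pi * c.muMicro) with hm
  set n := 1 / (2 * Real.pi * (c.kappaMicro + c.muMicro)) with hn
  set s := c.coefS - c.coefS * (c.kappaMicro - c.muMicro) / (c.kappaMicro + c.muMicro) with hs
  have hm0 : 0 < m := by have := hc.muMicro_pos; positivity
  have hn0 : 0 < n := by have := hc.muMicro_pos; have := hc.kappaMicro_pos; positivity
  refine ⟨2 / m + 2 / n, |2 * t| * (1 / c.ell2) / m + |s| * (1 / c.ell1) / n, by positivity,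
    fun x hx => ?_⟩
  have hr := norm_pos_iff.2 hx
  have hN := c.abs_greenP_le_normP x
  have e0 : m * (x 0 * (1 / ‖x‖ ^ 2)) = c.greenP 0 1 x - c.greenP 1 0 x
      - 2 * t * (x 0 * (Psi c.ell2 ‖x‖ / ‖x‖)) := by
    change _ = c.greenP12 x - c.greenP21 x - _
    rw [greenP12_eq h1 hx, greenP21_eq h1 hx]
    ring
  have e1 : n * (x 1 * (1 / ‖x‖ ^ 2)) = s * (x 1 * (Psi c.ell1 ‖x‖ / ‖x‖))
      - c.greenP 0 0 x - c.greenP 1 1 x := by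
    change _ = _ - c.greenP11 x - c.greenP22 x
    rw [greenP11_eq h1 hx, greenP22_eq h1 hx]
    ring
  have b0 : |x 0 * (1 / ‖x‖ ^ 2)| ≤ (2 * c.normP x + |2 * t| * (1 / c.ell2)) / m := by
    rw [le_div_iff₀ hm0, mul_comm, ← abs_of_pos hm0, ← abs_mul, e0]
    refine (abs_sub _ _).trans (add_le_add ((abs_sub _ _).trans ?_) ?_)
    · linarith [hN 0 1, hN 1 0]
    · rw [abs_mul]
      gcongr
      exact abs_coord_mul_Psi_le h2 hx 0
  have b1 : |x 1 * (1 / ‖x‖ ^ 2)| ≤ (2 * c.normP x + |s| * (1 / c.ell1)) / n := by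
    rw [le_div_iff₀ hn0, mul_comm, ← abs_of_pos hn0, ← abs_mul, e1]
    have b := abs_coord_mul_Psi_le h1 hx 1
    have b' : |s * (x 1 * (Psi c.ell1 ‖x‖ / ‖x‖))| ≤ |s| * (1 / c.ell1) := by
      rw [abs_mul]
      gcongr
    refine (abs_sub _ _).trans ?_
    have := abs_sub (s * (x 1 * (Psi c.ell1 ‖x‖ / ‖x‖))) (c.greenP 0 0 x)
    linarith [hN 0 0, hN 1 1]
  have hx1 : ‖x‖ ≤ |x 0| + |x 1| := by
    refine abs_le_of_sq_le_sq' ?_ (by positivity) |>.2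
    rw [norm_sq_eq, ← sq_abs (x 0), ← sq_abs (x 1)]
    nlinarith [abs_nonneg (x 0), abs_nonneg (x 1)]
  calc 1 / ‖x‖ = ‖x‖ * (1 / ‖x‖ ^ 2) := by field_simp
    _ ≤ (|x 0| + |x 1|) * (1 / ‖x‖ ^ 2) := by gcongr
    _ = |x 0 * (1 / ‖x‖ ^ 2)| + |x 1 * (1 / ‖x‖ ^ 2)| := by
      rw [abs_mul, abs_mul, abs_of_nonneg (by positivity : 0 ≤ 1 / ‖x‖ ^ 2)]
      ring
    _ ≤ _ := add_le_add b0 b1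
    _ = _ := by ring

theorem isTheta_normP (hc : c.PositiveDefinite) (h1 : 0 < c.ell1) (h2 : 0 < c.ell2) :
    c.normP =Θ[𝓝[≠] (0 : Plane)] fun x => 1 / ‖x‖ := by
  constructor
  · have h : (fun x => ∑ i, ∑ j, |c.greenP i j x|) =O[𝓝[≠] (0 : Plane)] fun x => 1 / ‖x‖ :=
      IsBigO.fun_sum fun i _ => IsBigO.fun_sum fun j _ => (tame_greenP h1 h2 i j).2.abs_left
    refine (IsBigO.of_bound 1 (Eventually.of_forall fun x => ?_)).trans h
    have hs : 0 ≤ ∑ i, ∑ j, |c.greenP i j x| := by positivity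
    rw [normP, Real.norm_of_nonneg (Real.sqrt_nonneg _), Real.norm_of_nonneg hs, one_mul]
    refine Real.sqrt_le_iff.2 ⟨hs, ?_⟩
    simp only [Fin.sum_univ_two]
    rw [← sq_abs (c.greenP 0 0 x), ← sq_abs (c.greenP 0 1 x), ← sq_abs (c.greenP 1 0 x),
      ← sq_abs (c.greenP 1 1 x)]
    have a1 := abs_nonneg (c.greenP 0 0 x)
    have a2 := abs_nonneg (c.greenP 0 1 x)
    have a3 := abs_nonneg (c.greenP 1 0 x)
    have a4 := abs_nonneg (c.greenP 1 1 x)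
    rw [← sub_nonneg]
    ring_nf
    positivity
  · obtain ⟨A, B, hA, h⟩ := exists_one_div_norm_le hc h1 h2
    refine IsBigO.of_bound (2 * A) ?_
    -- Within this radius `B ≤ 1 / (2r)`, so the additive constant is absorbed at the cost of
    -- doubling `A`.
    have hB : 0 < 1 / (2 * (|B| + 1)) := by positivity
    filter_upwards [self_mem_nhdsWithin, mem_nhdsWithin_of_mem_nhds
      (Metric.closedBall_mem_nhds (0 : Plane) hB)] with x hx hxB
    have hr : 0 < ‖x‖ := norm_pos_iff.2 hx
    have hxB' : ‖x‖ ≤ 1 / (2 * (|B| + 1)) := by simpa using hxB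
    have h3 : 2 * (|B| + 1) ≤ 1 / ‖x‖ := by
      rw [le_div_iff₀ hr]
      rwa [le_div_iff₀ (by positivity), mul_comm] at hxB'
    rw [Real.norm_of_nonneg (by positivity), Real.norm_of_nonneg (show 0 ≤ c.normP x from Real.sqrt_nonneg _)]
    have h4 := h x hx
    have h5 := le_abs_self B
    linarith

end Moduli

end RelaxedMicromorphic

/-! ### The main theorem. -/

open RelaxedMicromorphic
/-- The closed-form displacement `u` and micro-distortion `P` are locally integrable and solve the
plane-strain equilibrium equations on `ℝ²` with the concentrated force `f = (0, -1) δ` and `M = 0`;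
near the origin `u₁` is bounded, `u₂ = -C log r + O(1)` with `C > 0`, and `P` has exactly an
`1 / r` singularity. -/
theorem mainTheorem1 (c : Moduli) (hc : c.PositiveDefinite) (hmuC : 0 < c.muC)
    (hLc : 0 < c.Lc) :
    (∀ i, LocallyIntegrable (c.greenU i) volume) ∧
    (∀ i j, LocallyIntegrable (c.greenP i j) volume) ∧
    c.Equilibrium (fun i => regularDist (c.greenU i))
      (Matrix.of fun i j => regularDist (c.greenP i j))
      ![0, -Distribution.delta (0 : Plane)] 0 ∧
    (c.greenU 0 =O[𝓝[≠] (0 : Plane)] fun _ => (1 : ℝ)) ∧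
    (∃ C : ℝ, 0 < C ∧
      (fun x => c.greenU 1 x + C * Real.log ‖x‖) =O[𝓝[≠] (0 : Plane)] fun _ => (1 : ℝ)) ∧
    (∀ i j, c.greenP i j =O[𝓝[≠] (0 : Plane)] fun x => 1 / ‖x‖) ∧
    (fun x => √(∑ i, ∑ j, c.greenP i j x ^ 2)) =Θ[𝓝[≠] (0 : Plane)] fun x => 1 / ‖x‖ := by
  have h1 := Moduli.ell1_pos hc hLc
  have h2 := Moduli.ell2_pos hc hmuC hLc
  have hU : (fun i => regularDist (c.greenU i)) = c.distU :=
    funext fun i => (Moduli.represents_greenU h1 h2 i).2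
  have hP : (Matrix.of fun i j => regularDist (c.greenP i j)) = c.distP := by
    ext1 i j
    exact (Moduli.represents_greenP h1 h2 i j).2
  refine ⟨fun i => (Moduli.represents_greenU h1 h2 i).1,
    fun i j => (Moduli.represents_greenP h1 h2 i j).1, ?_, Moduli.isBigO_greenU1 h1 h2,
    ⟨_, Moduli.coefLog_sub_pos hc hmuC, Moduli.isBigO_greenU2 h1 h2⟩,
    fun i j => (Moduli.tame_greenP h1 h2 i j).2, Moduli.isTheta_normP hc h1 h2⟩
  rw [hU, hP]
  exact Moduli.equilibrium_dist hc hmuC hLc
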